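/- **Model.** Consider a fog radio access network with two edge nodes (ENs) $m\in\{1,2\}$, two users $k\in\{1,2\}$ and a library of $J$ independent files $F_1,\dots,F_J$, each uniformly distributed on $\{0,1\}^L$. The channel coefficients $H_{m,k}\in\mathbb C$ are i.i.d. with an atomless law, constant during a transmission, independent of the files, and known everywhere; write $\mathcal H=(H_{m,k})$. Logarithms are to base $2$, entropies are in bits, $P>1$ is the SNR and $r>0$ the fronthaul rate. Let $\boldsymbol\mu=(\mu_{m,j})$, $m\in\{1,2\}$, $1\le j\le J$, be a cache partition matrix with entries in $[0,1]$ (possibly $\mu_{1,j}\ne\mu_{2,j}$). A policy for $(L,P)$ consists of the following. EN $m$ caches $S_{m,j}=\pi^c_{m,j}(F_j)$ with $H(S_{m,j})\le\mu_{m,j}L$ for every $j$. For each request vector $D=(D_1,D_2)$ with $D_1\neq D_2$ there are durations $n^f_D,n^e_D\in\mathbb N$; the cloud sends to EN $m$ a message $U_m=\pi^f_m(D,F_1,\dots,F_J,\mathcal H)$ with $H(U_m\mid\mathcal H)\le n^f_D\,r\log P$; EN $m$ transmits $X_m=\pi^e_m(D,(S_{m,j})_j,U_m,\mathcal H)\in\mathbb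 C^{n^e_D}$ with $\mathbb E\|X_m\|^2\le n^e_D P$; user $k$ receives $Y_k=\sum_{m=1}^2H_{m,k}X_m+Z_k$, where the entries of $Z_k$ are i.i.d. circularly symmetric complex Gaussian of unit power, independent of everything else, and decodes $\hat F_{k}=\pi^d_k(Y_k,D,\mathcal H)$. Let $P_e=\max_D\max_k\Pr(\hat F_k\ne F_{D_k})$. A family of policies indexed by $(L,P)$ is feasible if $\lim_{P\to\infty}\lim_{L\to\infty}P_e=0$. Its fronthaul and edge normalized delivery times (NDTs) are $\delta^x_D=\lim_{P\to\infty}\lim_{L\to\infty}\frac{n^x_D}{L/\log P}$, $x\in\{f,e\}$, and $\delta_D=\delta^f_D+\delta^e_D$; these limits are required to exist, and $\delta_D$ is required to be the same for both orderings of $D$, so that it is written $\delta_{i,j}$ for $D=\{i,j\}$. The NDT region $\Delta^*(\boldsymbol\mu,r)$ is the set of all tuples $(\delta_{i,j})_{\{i,j\}\subseteq\{1,\dots,J\},\,i\ne j}$ obtained from feasible families. **Theorem.** For every $r>0$ and every cache partition matrix $\boldsymbol\mu$, every tuple in $\Delta^*(\boldsymbol\mu,r)$ satisfies $\delta_{i,j}\ge\delta^{(\mathrm{out})}_{i,j}(\boldsymbol\mu,r)$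 for all $i\ne j$, where, with $\underline\mu_{i,j}=\min\{\mu_{1,i},\mu_{2,i},\mu_{1,j},\mu_{2,j}\}$, $$\delta^{(\mathrm{out})}_{i,j}(\boldsymbol\mu,r)=\begin{cases}\max\{a_1,a_2,a_3\},& r\le1,\\ 1+\frac1r-\frac1r\,\underline\mu_{i,j},& r>1,\end{cases}$$ $$a_1=1+\tfrac1r-\underline\mu_{i,j}-\tfrac12\left(\tfrac1r-1\right)(\mu_{1,i}+\mu_{2,i}+\mu_{1,j}+\mu_{2,j}),$$ $$a_2=\tfrac32+\tfrac1{2r}-\underline\mu_{i,j}-\tfrac12\left(\tfrac1r-1\right)\min\{\mu_{1,i}+\mu_{2,i},\ \mu_{1,j}+\mu_{2,j}\},\qquad a_3=2-\underline\mu_{i,j}.$$ -/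

import Mathlib

open MeasureTheory ProbabilityTheory Filter Topology

noncomputable section

namespace FRAN

/-! Fog radio access network with two edge nodes (ENs), two users and a library of `J` files. -/

/-- A file of `L` bits. -/
abbrev File (L : ℕ) : Type := Fin L → Bool

/-- The content library: `J` files of `L` bits each. -/
abbrev Library (J L : ℕ) : Type := Fin J → File L

/-- Channel state information: `h m k` is the coefficient from EN `m` to user `k`. -/
abbrev CSI : Type := Fin 2 → Fin 2 → ℂ

/-- A block of `n` complex channel symbols. -/
abbrev Signal (n : ℕ) : Type := Fin n → ℂ

/-- A request vector: user `k` requests the file with index `D k`; requested files are distinct. -/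
abbrev Demand (J : ℕ) : Type := Fin 2 ↪ Fin J

/-- The files are independent and uniformly distributed bit strings. -/
def libraryLaw (J L : ℕ) : Measure (Library J L) := uniformOn Set.univ

/-- The channel coefficients are i.i.d. over ENs and users, with law `ν`. -/
def csiLaw (ν : Measure ℂ) : Measure CSI := Measure.pi fun _ => Measure.pi fun _ => ν

/-- Circularly symmetric complex Gaussian law with unit power: independent real and imaginary
parts of variance `1 / 2`. -/
def complexGaussian : Measure ℂ :=
  ((gaussianReal 0 (1 / 2)).prod (gaussianReal 0 (1 / 2))).map
    (fun p : ℝ × ℝ => (⟨p.1, p.2⟩ : ℂ))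

/-- Receiver noise: i.i.d. over the two users and the `n` symbols. -/
def noiseLaw (n : ℕ) : Measure (Fin 2 → Signal n) :=
  Measure.pi fun _ => Measure.pi fun _ => complexGaussian

/-- Joint law of the files, the channel and the noise, which are independent. -/
def systemLaw (J L n : ℕ) (ν : Measure ℂ) :
    Measure (Library J L × CSI × (Fin 2 → Signal n)) :=
  (libraryLaw J L).prod ((csiLaw ν).prod (noiseLaw n))

/-- Shannon entropy, in bits, of a random variable on a finite probability space. -/
def entropy {Ω : Type*} [Fintype Ω] [MeasurableSpace Ω] (p : Measure Ω) (X : Ω → ℕ) : ℝ :=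
  ∑ a ∈ Finset.univ.image X, Real.negMulLog (p.real (X ⁻¹' {a})) / Real.log 2

/-- A caching, fronthaul, edge transmission and decoding policy for files of `L` bits, together
with the durations (in channel symbols) of the two delivery subslots for each request vector.
As the library is finite, it is no restriction that cached contents and fronthaul
messages are labelled by natural numbers. -/
structure Policy (J L : ℕ) where
  /-- Duration `n^f_D` of the fronthaul subslot. -/
  fronthaulTime : Demand J → ℕ
  /-- Duration `n^e_D` of the edge subslot. -/
  edgeTime : Demand J → ℕ
  /-- `S_{m,j}` as a function of the file `F_j`. -/
  cache : Fin 2 → Fin J → File L → ℕ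
  /-- `U_m` as a function of the demand, the library and the CSI. -/
  fronthaul : Fin 2 → Demand J → Library J L → CSI → ℕ
  /-- `X_m` as a function of the demand, `(S_{m,j})_j`, `U_m` and the CSI. -/
  edge : Fin 2 → (D : Demand J) → (Fin J → ℕ) → ℕ → CSI → Signal (edgeTime D)
  /-- The decision of user `k`, as a function of the demand, `Y_k` and the CSI. -/
  decode : Fin 2 → (D : Demand J) → Signal (edgeTime D) → CSI → File L
  measurable_fronthaul : ∀ m D F, Measurable (fronthaul m D F)
  measurable_edge : ∀ m D s u, Measurable (edge m D s u)
  measurable_decode : ∀ k D, Measurable fun p : Signal (edgeTime D) × CSI => decode k D p.1 p.2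

namespace Policy

variable {J L : ℕ} (π : Policy J L)

/-- The codeword `X_m` transmitted by EN `m`. -/
def codeword (m : Fin 2) (D : Demand J) (F : Library J L) (h : CSI) : Signal (π.edgeTime D) :=
  π.edge m D (fun j => π.cache m j (F j)) (π.fronthaul m D F h) h

/-- The received signal `Y_k = ∑ m, H_{m,k} X_m + Z_k`. -/
def received (k : Fin 2) (D : Demand J) (F : Library J L) (h : CSI)
    (z : Fin 2 → Signal (π.edgeTime D)) : Signal (π.edgeTime D) :=
  fun t => ∑ m, h m k * π.codeword m D F h t + z k t

/-- Error probability of user `k` for the request vector `D`. -/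
def errorProb (ν : Measure ℂ) (D : Demand J) (k : Fin 2) : ℝ :=
  (systemLaw J L (π.edgeTime D) ν).real
    {ω | π.decode k D (π.received k D ω.1 ω.2.1 ω.2.2) ω.2.1 ≠ ω.1 (D k)}

/-- Worst-case error probability over requests and users. -/
def maxErrorProb (ν : Measure ℂ) : ℝ := ⨆ D : Demand J, ⨆ k : Fin 2, π.errorProb ν D k

/-- At EN `m` the content cached of file `j` has entropy at most `μ m j * L` bits. -/
def CacheConstraint (μ : Fin 2 → Fin J → ℝ) : Prop :=
  ∀ m j, entropy (libraryLaw J L) (fun F => π.cache m j (F j)) ≤ μ m j * L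

/-- The fronthaul links have capacity `r log₂ P` bits per symbol. The CSI is known throughout the
network, so the entropy of `U_m` is the one given the CSI. -/
def FronthaulConstraint (ν : Measure ℂ) (r P : ℝ) : Prop :=
  ∀ m D, ∫ h, entropy (libraryLaw J L) (fun F => π.fronthaul m D F h) ∂(csiLaw ν)
    ≤ r * Real.logb 2 P * π.fronthaulTime D

/-- The average transmit power of each EN is at most `P` per symbol. -/
def PowerConstraint (ν : Measure ℂ) (P : ℝ) : Prop :=
  ∀ m D, ∫⁻ ω, ENNReal.ofReal (∑ t, ‖π.codeword m D ω.1 ω.2 t‖ ^ 2)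
      ∂((libraryLaw J L).prod (csiLaw ν))
    ≤ ENNReal.ofReal (π.edgeTime D * P)

end Policy

/-- The iterated limit `lim_{P → ∞} lim_{L → ∞} f L P` exists and equals `a`. -/
def IteratedLimit (f : ℕ → ℝ → ℝ) (a : ℝ) : Prop :=
  ∃ g : ℝ → ℝ, (∀ᶠ P in atTop, Tendsto (fun L => f L P) atTop (𝓝 (g P))) ∧
    Tendsto g atTop (𝓝 a)

/-- A set of two distinct requested files. -/
abbrev RequestSet (J : ℕ) : Type := {s : Finset (Fin J) // s.card = 2}

/-- The request set `{i, j}`. -/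
def pairSet {J : ℕ} (i j : Fin J) (hij : i ≠ j) : RequestSet J := ⟨{i, j}, Finset.card_pair hij⟩

/-- The set of files requested in the request vector `D`. -/
def Demand.toSet {J : ℕ} (D : Demand J) : RequestSet J :=
  ⟨Finset.univ.map D, by simp⟩

/-- The family `π`, parametrized by the file length `L` and the SNR `P`, meets the cache, fronthaul
and power constraints, and is feasible: its error probability vanishes. -/
structure IsFeasible {J : ℕ} (ν : Measure ℂ) (r : ℝ) (μ : Fin 2 → Fin J → ℝ)
    (π : (L : ℕ) → ℝ → Policy J L) : Prop where
  cache : ∀ L P, 1 < P → (π L P).CacheConstraint μ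
  fronthaul : ∀ L P, 1 < P → (π L P).FronthaulConstraint ν r P
  power : ∀ L P, 1 < P → (π L P).PowerConstraint ν P
  error : IteratedLimit (fun L P => (π L P).maxErrorProb ν) 0

/-- The NDT region for a given cache partition matrix: all tuples `δ`, indexed by request sets, such
that some feasible family has fronthaul and edge NDTs that sum to `δ` at the request set, for both
orderings of each request set. -/
def ndtRegion {J : ℕ} (ν : Measure ℂ) (r : ℝ) (μ : Fin 2 → Fin J → ℝ) :
    Set (RequestSet J → ℝ) :=
  {δ | ∃ π : (L : ℕ) → ℝ → Policy J L, IsFeasible ν r μ π ∧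
    ∃ δf δe : Demand J → ℝ,
      (∀ D, IteratedLimit
        (fun L P => ((π L P).fronthaulTime D : ℝ) / ((L : ℝ) / Real.logb 2 P)) (δf D)) ∧
      (∀ D, IteratedLimit
        (fun L P => ((π L P).edgeTime D : ℝ) / ((L : ℝ) / Real.logb 2 P)) (δe D)) ∧
      ∀ D : Demand J, δ D.toSet = δe D + δf D}

section OuterBound

variable {J : ℕ} (μ : Fin 2 → Fin J → ℝ) (r : ℝ) (i j : Fin J)

/-- `min {μ_{1,i}, μ_{2,i}, μ_{1,j}, μ_{2,j}}`. -/
def minCache : ℝ := min (min (μ 0 i) (μ 1 i)) (min (μ 0 j) (μ 1 j))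

def outer1 : ℝ :=
  1 + 1 / r - minCache μ i j
    - 1 / 2 * (1 / r - 1) * (μ 0 i + μ 1 i + μ 0 j + μ 1 j)

def outer2 : ℝ :=
  3 / 2 + 1 / (2 * r) - minCache μ i j
    - 1 / 2 * (1 / r - 1) * min (μ 0 i + μ 1 i) (μ 0 j + μ 1 j)

def outer3 : ℝ := 2 - minCache μ i j

def outer4 : ℝ := 1 + 1 / r - 1 / r * minCache μ i j

/-- The lower bound on the NDT of the request set `{i, j}`; it is symmetric in `i` and `j`. -/
def outerBound : ℝ :=
  if r ≤ 1 then max (outer1 μ r i j) (max (outer2 μ r i j) (outer3 μ i j))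
  else outer4 μ r i j

/-- The tuples that satisfy the lower bound at every request set. -/
def outerRegion : Set (RequestSet J → ℝ) :=
  {δ | ∀ (i j : Fin J) (hij : i ≠ j), outerBound μ r i j ≤ δ (pairSet i j hij)}

end OuterBound

end FRAN

end

/-!
Every bound comes from one counting argument. An observation has a code length `c`, such as
`-log p` for a message or minus the logarithm of a reference density for a received signal. If an
observation determines `a` of the files, the others being given, then Kraft's inequality bounds the
integral of `exp (-c)` over the event of correct decoding by `2 ^ (-a * L)`, and integrating
`log x ≤ x - 1` bounds `a * L * log 2` times the probability of that event by `1 + 𝔼 c`. A message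
costs its entropy, and a received signal about `log P` per symbol, namely its code length under the
complex Gaussian law of power `P`; no differential entropy is involved.

The bound is applied to three observations: the signal at one user; the fronthaul messages with the
cached contents of the requested files; and the signal at one user with the fronthaul message of
one EN and its cached content of the other user's file. In the last case, the codeword of that EN is
known once the first file is decoded, and up to noise the signal at one user is a multiple of the
signal at the other plus a multiple of that codeword. The missing combination of the noises is
supplied as a residual, which costs a bounded amount per symbol, so that it disappears at high SNR.
This needs the channel coefficients to be bounded above and away from zero, which holds with
probability close to `1`. The outer bound is a combination of the limits of these inequalities.
-/

noncomputable section

namespace FRAN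

open scoped ENNReal NNReal

/-! ### Code lengths -/

section CodeLength

variable {Ω : Type*} [MeasurableSpace Ω] {ρ : Measure Ω} [IsFiniteMeasure ρ] {c : Ω → ℝ} {M : ℝ}

theorem measureReal_univ_mul_log_le_one_add_integral (hM : 0 < M) (hc : Integrable c ρ)
    (h : ∫⁻ ω, ENNReal.ofReal (Real.exp (-c ω)) ∂ρ ≤ ENNReal.ofReal M⁻¹) :
    ρ.real Set.univ * Real.log M ≤ 1 + ∫ ω, c ω ∂ρ := by
  have hexp0 : 0 ≤ᵐ[ρ] fun ω => Real.exp (-c ω) := ae_of_all _ fun _ => (Real.exp_pos _).le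
  have hmeas : AEStronglyMeasurable (fun ω => Real.exp (-c ω)) ρ :=
    Real.continuous_exp.comp_aestronglyMeasurable hc.1.neg
  have hexp : Integrable (fun ω => Real.exp (-c ω)) ρ :=
    ⟨hmeas, (hasFiniteIntegral_iff_ofReal hexp0).2 (h.trans_lt ENNReal.ofReal_lt_top)⟩
  have hint : M * ∫ ω, Real.exp (-c ω) ∂ρ ≤ 1 := by
    rw [integral_eq_lintegral_of_nonneg_ae hexp0 hmeas, ← le_inv_mul_iff₀ hM, mul_one]
    exact ENNReal.toReal_le_of_le_ofReal (inv_pos.2 hM).le h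
  have hpt : ∀ ω, Real.log M ≤ M * Real.exp (-c ω) + c ω := fun ω => by
    have := Real.log_le_sub_one_of_pos (mul_pos hM (Real.exp_pos (-c ω)))
    rw [Real.log_mul hM.ne' (Real.exp_pos _).ne', Real.log_exp] at this
    linarith
  calc ρ.real Set.univ * Real.log M = ∫ _, Real.log M ∂ρ := by simp
    _ ≤ ∫ ω, (M * Real.exp (-c ω) + c ω) ∂ρ :=
      integral_mono (integrable_const _) ((hexp.const_mul M).add hc) hpt
    _ = M * (∫ ω, Real.exp (-c ω) ∂ρ) + ∫ ω, c ω ∂ρ := by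
      rw [integral_add (hexp.const_mul M) hc, integral_const_mul]
    _ ≤ 1 + ∫ ω, c ω ∂ρ := by linarith

theorem measureReal_mul_log_le_one_add_integral {C : Set Ω} (hM : 0 < M) (hc : Integrable c ρ)
    (hc0 : 0 ≤ c) (h : ∫⁻ ω in C, ENNReal.ofReal (Real.exp (-c ω)) ∂ρ ≤ ENNReal.ofReal M⁻¹) :
    ρ.real C * Real.log M ≤ 1 + ∫ ω, c ω ∂ρ := by
  have := measureReal_univ_mul_log_le_one_add_integral hM hc.restrict h
  rw [measureReal_restrict_apply_univ] at this
  linarith [setIntegral_le_integral (s := C) hc (ae_of_all _ hc0)]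

end CodeLength

section Surprisal

variable {Ω α : Type*} [MeasurableSpace Ω] (p : Measure Ω)

/-- The information content `-log p(X = X ω)`, in nats, of the observed value of `X`: its ideal
code length, whose mean is the entropy of `X`. -/
def surprisal (X : Ω → α) (ω : Ω) : ℝ := -Real.log (p.real (X ⁻¹' {X ω}))

theorem surprisal_nonneg [IsProbabilityMeasure p] (X : Ω → α) (ω : Ω) : 0 ≤ surprisal p X ω :=
  neg_nonneg.2 (Real.log_nonpos measureReal_nonneg measureReal_le_one)

variable {p}

theorem surprisal_le_neg_log_singleton [IsFiniteMeasure p] {ω : Ω} (hp : 0 < p.real {ω})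
    (X : Ω → α) : surprisal p X ω ≤ -Real.log (p.real {ω}) :=
  neg_le_neg (Real.log_le_log hp (measureReal_mono (by simp)))

theorem exp_neg_surprisal [IsFiniteMeasure p] {ω : Ω} (hp : 0 < p.real {ω}) (X : Ω → α) :
    Real.exp (-surprisal p X ω) = p.real (X ⁻¹' {X ω}) := by
  rw [surprisal, neg_neg, Real.exp_log (hp.trans_le (measureReal_mono (by simp)))]

variable (p)

theorem measurable_surprisal_of_forall [Finite Ω] {β : Type*} [MeasurableSpace β]
    {V : Ω → β → ℕ} (hV : ∀ ω, Measurable (V ω)) (ω : Ω) :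
    Measurable fun b => surprisal p (fun ω' => V ω' b) ω :=
  (measurable_of_countable fun X : Ω → ℕ => surprisal p X ω).comp (measurable_pi_iff.2 hV)

variable [MeasurableSingletonClass Ω]

theorem integral_surprisal [Fintype Ω] [IsFiniteMeasure p] (X : Ω → ℕ) :
    ∫ ω, surprisal p X ω ∂p = entropy p X * Real.log 2 := by
  classical
  have hfiber : ∀ a, ∑ ω with X ω = a, p.real {ω} * surprisal p X ω
      = Real.negMulLog (p.real (X ⁻¹' {a})) := fun a => by
    calc ∑ ω with X ω = a, p.real {ω} * surprisal p X ω
        = ∑ ω with X ω = a, p.real {ω} * -Real.log (p.real (X ⁻¹' {a})) :=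
          Finset.sum_congr rfl fun ω hω => by rw [surprisal, (Finset.mem_filter.1 hω).2]
      _ = Real.negMulLog (p.real (X ⁻¹' {a})) := by
          rw [← Finset.sum_mul, sum_measureReal_singleton, Finset.coe_filter_univ,
            Real.negMulLog, neg_mul, mul_neg]
          rfl
  rw [integral_fintype .of_finite, entropy, Finset.sum_mul,
    ← Finset.sum_fiberwise_of_maps_to (g := X) (t := Finset.univ.image X) (by simp)]
  refine Finset.sum_congr rfl fun a _ => ?_
  rw [div_mul_cancel₀ _ (Real.log_pos one_lt_two).ne']
  simpa only [smul_eq_mul] using hfiber a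

variable {p} [IsProbabilityMeasure p] {ι R : Type*} [Fintype ι] [Fintype R]

theorem sum_exp_neg_surprisal_le_card [Countable Ω] (hp : ∀ ω, 0 < p.real {ω})
    {W : Ω → R} {V : ι → Ω → α} {C : Finset Ω}
    (hC : Set.InjOn (fun ω => (W ω, fun i => V i ω)) C) :
    ∑ ω ∈ C, Real.exp (-∑ i, surprisal p (V i) ω) ≤ Fintype.card R := by
  classical
  let q : R × (ι → α) → ℝ := fun x => ∏ i, p.real (V i ⁻¹' {x.2 i})
  let values : Finset (ι → α) := Fintype.piFinset fun i => C.image (V i)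
  calc ∑ ω ∈ C, Real.exp (-∑ i, surprisal p (V i) ω)
      = ∑ ω ∈ C, q (W ω, fun i => V i ω) := by
        simp only [← Finset.sum_neg_distrib, Real.exp_sum, exp_neg_surprisal (hp _), q]
    _ = ∑ x ∈ C.image fun ω => (W ω, fun i => V i ω), q x := (Finset.sum_image hC).symm
    _ ≤ ∑ x ∈ Finset.univ ×ˢ values, q x := by
        refine Finset.sum_le_sum_of_subset_of_nonneg ?_ fun _ _ _ =>
          Finset.prod_nonneg fun _ _ => measureReal_nonneg
        exact Finset.image_subset_iff.2 fun ω hω => by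
          simpa [values, Fintype.mem_piFinset] using fun i => ⟨ω, hω, rfl⟩
    _ = ∑ _ : R, ∏ i, ∑ a ∈ C.image (V i), p.real (V i ⁻¹' {a}) := by
        rw [Finset.sum_product, Finset.prod_univ_sum]
    _ ≤ Fintype.card R := by
        have hsum : ∀ i, ∑ a ∈ C.image (V i), p.real (V i ⁻¹' {a}) ≤ 1 := fun i => by
          rw [sum_measureReal_preimage_singleton _ fun _ _ => (Set.to_countable _).measurableSet]
          exact measureReal_le_one
        refine (Finset.sum_le_sum fun _ _ => Finset.prod_le_one (fun i _ => ?_)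
          fun i _ => hsum i).trans_eq (by simp)
        exact Finset.sum_nonneg fun _ _ => measureReal_nonneg

theorem sum_exp_neg_surprisal_mul_measureReal_le_card [Fintype Ω] (hp : ∀ ω, 0 < p.real {ω})
    {W : Ω → R} {V : ι → Ω → α} {Y : Type*} [MeasurableSpace Y]
    (Q : Measure Y) [IsProbabilityMeasure Q] {S : Ω → Set Y} (hS : ∀ ω, MeasurableSet (S ω))
    (h : ∀ y, Set.InjOn (fun ω => (W ω, fun i => V i ω)) {ω | y ∈ S ω}) :
    ∑ ω, Real.exp (-∑ i, surprisal p (V i) ω) * Q.real (S ω) ≤ Fintype.card R := by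
  classical
  have hint : ∀ ω, Integrable (fun y =>
      Real.exp (-∑ i, surprisal p (V i) ω) * (S ω).indicator 1 y) Q := fun ω =>
    ((integrable_const 1).indicator (hS ω)).const_mul _
  have hpt : ∀ y, ∑ ω, Real.exp (-∑ i, surprisal p (V i) ω) * (S ω).indicator 1 y
      ≤ Fintype.card R := fun y => by
    simpa [Set.indicator_apply, Finset.sum_filter] using
      sum_exp_neg_surprisal_le_card (C := Finset.univ.filter (y ∈ S ·)) hp (by simpa using h y)
  calc ∑ ω, Real.exp (-∑ i, surprisal p (V i) ω) * Q.real (S ω)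
      = ∫ y, ∑ ω, Real.exp (-∑ i, surprisal p (V i) ω) * (S ω).indicator 1 y ∂Q := by
        rw [integral_finsetSum _ fun ω _ => hint ω]
        simp only [integral_const_mul, integral_indicator_one (hS _)]
    _ ≤ ∫ _, (Fintype.card R : ℝ) ∂Q :=
        integral_mono (integrable_finsetSum _ fun ω _ => hint ω) (integrable_const _) hpt
    _ = Fintype.card R := by simp

end Surprisal

/-! ### The library -/

section Library

variable {J L : ℕ}

instance : IsProbabilityMeasure (libraryLaw J L) :=
  isProbabilityMeasure_uniformOn Set.finite_univ Set.univ_nonempty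

theorem libraryLaw_singleton (F : Library J L) :
    libraryLaw J L {F} = (Fintype.card (Library J L) : ℝ≥0∞)⁻¹ := by
  rw [libraryLaw, uniformOn_univ, Measure.count_singleton, one_div]

theorem libraryLaw_real_singleton (F : Library J L) :
    (libraryLaw J L).real {F} = (Fintype.card (Library J L) : ℝ)⁻¹ := by
  rw [measureReal_def, libraryLaw_singleton, ENNReal.toReal_inv, ENNReal.toReal_natCast]

theorem libraryLaw_real_singleton_pos (F : Library J L) : 0 < (libraryLaw J L).real {F} := by
  rw [libraryLaw_real_singleton, inv_pos, Nat.cast_pos]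
  exact Fintype.card_pos

theorem surprisal_libraryLaw_le {α : Type*} (X : Library J L → α) (F : Library J L) :
    surprisal (libraryLaw J L) X F ≤ Real.log (Fintype.card (Library J L)) := by
  simpa [libraryLaw_real_singleton] using
    surprisal_le_neg_log_singleton (libraryLaw_real_singleton_pos F) X

theorem card_unrequested_mul_pow (I : Finset (Fin J)) :
    Fintype.card ({j // j ∉ I} → File L) * 2 ^ (L * I.card) = Fintype.card (Library J L) := by
  have hI : I.card ≤ J := by simpa using Finset.card_le_univ I
  have hc : Fintype.card {j // j ∉ I} = J - I.card := by simp [Fintype.card_subtype_compl]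
  simp only [Fintype.card_fun, Fintype.card_bool, Fintype.card_fin, hc]
  rw [← pow_mul, ← pow_add, ← pow_mul, ← Nat.mul_add, Nat.sub_add_cancel hI]

/-- With `S F` the set of observations accepted when the library is `F`: an accepted observation,
the side information `V` and the files outside `I` together determine the files in `I`. -/
def Resolves {ι Y : Type*} (I : Finset (Fin J)) (V : ι → Library J L → ℕ)
    (S : Library J L → Set Y) : Prop :=
  ∀ ⦃y F F'⦄, y ∈ S F → y ∈ S F' → (∀ j ∉ I, F j = F' j) → (∀ i, V i F = V i F') →
    ∀ j ∈ I, F j = F' j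

theorem Resolves.lintegral_le {ι Y : Type*} [Fintype ι] [MeasurableSpace Y] {I : Finset (Fin J)}
    {V : ι → Library J L → ℕ} {S : Library J L → Set Y} (h : Resolves I V S) (Q : Measure Y)
    [IsProbabilityMeasure Q] (hS : ∀ F, MeasurableSet (S F)) :
    ∫⁻ F, ENNReal.ofReal (Real.exp (-∑ i, surprisal (libraryLaw J L) (V i) F)) * Q (S F)
        ∂libraryLaw J L
      ≤ ENNReal.ofReal ((2 : ℝ) ^ (L * I.card))⁻¹ := by
  let W : Library J L → {j // j ∉ I} → File L := fun F j => F j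
  have hinj : ∀ y, Set.InjOn (fun F => (W F, fun i => V i F)) {F | y ∈ S F} := by
    intro y F hF F' hF' hFF'
    have hout : ∀ j ∉ I, F j = F' j := fun j hj => congrFun (congrArg Prod.fst hFF') ⟨j, hj⟩
    have hin := h hF hF' hout (congrFun (congrArg Prod.snd hFF'))
    exact funext fun j => if hj : j ∈ I then hin j hj else hout j hj
  have hcard : (Fintype.card ({j // j ∉ I} → File L) : ℝ) * (Fintype.card (Library J L) : ℝ)⁻¹
      = ((2 : ℝ) ^ (L * I.card))⁻¹ := by
    rw [← card_unrequested_mul_pow I]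
    push_cast
    rw [mul_inv, mul_inv_cancel_left₀ (by positivity)]
  calc ∫⁻ F, ENNReal.ofReal (Real.exp (-∑ i, surprisal (libraryLaw J L) (V i) F)) * Q (S F)
        ∂libraryLaw J L
      = ENNReal.ofReal ((∑ F, Real.exp (-∑ i, surprisal (libraryLaw J L) (V i) F)
          * Q.real (S F)) * (Fintype.card (Library J L) : ℝ)⁻¹) := by
        rw [lintegral_fintype, ENNReal.ofReal_mul (by positivity),
          ENNReal.ofReal_sum_of_nonneg fun _ _ => by positivity, Finset.sum_mul,
          ENNReal.ofReal_inv_of_pos (Nat.cast_pos.2 Fintype.card_pos), ENNReal.ofReal_natCast]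
        simp only [libraryLaw_singleton, ENNReal.ofReal_mul (Real.exp_pos _).le,
          ofReal_measureReal (measure_ne_top Q _)]
    _ ≤ ENNReal.ofReal ((2 : ℝ) ^ (L * I.card))⁻¹ := by
        rw [← hcard]
        gcongr
        exact sum_exp_neg_surprisal_mul_measureReal_le_card libraryLaw_real_singleton_pos Q hS hinj

theorem Resolves.lintegral_setLIntegral_le {ι Y Z : Type*} [Fintype ι] [MeasurableSpace Y]
    [MeasurableSpace Z] {I : Finset (Fin J)} {V : ι → Library J L → ℕ} {S : Library J L → Set Y}
    (h : Resolves I V S) (Q : Measure Y) [IsProbabilityMeasure Q] (hS : ∀ F, MeasurableSet (S F))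
    {N : Measure Z} {T : Library J L → Set Z} {c : Library J L → Z → ℝ}
    (hc : ∀ F, ∫⁻ z in T F, ENNReal.ofReal (Real.exp (-c F z)) ∂N ≤ Q (S F)) :
    ∫⁻ F, ∫⁻ z in T F, ENNReal.ofReal (Real.exp
        (-(∑ i, surprisal (libraryLaw J L) (V i) F + c F z))) ∂N ∂libraryLaw J L
      ≤ ENNReal.ofReal ((2 : ℝ) ^ (L * I.card))⁻¹ := by
  refine le_trans (lintegral_mono fun F => ?_) (h.lintegral_le Q hS)
  simp only [neg_add _ (c F _), Real.exp_add, ENNReal.ofReal_mul (Real.exp_pos _).le]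
  rw [lintegral_const_mul' _ _ ENNReal.ofReal_ne_top]
  exact mul_le_mul_right (hc F) _

end Library

/-! ### Gaussian laws -/

section Tilt

variable {α β : Type*} [MeasurableSpace α] [MeasurableSpace β] {μ : Measure α} {lam : Measure β}

theorem setLIntegral_preimage_comp_le_withDensity {U : α → β} (hU : Measurable U)
    (hle : μ.map U ≤ lam) {w : β → ℝ≥0∞} (hw : Measurable w) {S : Set β} (hS : MeasurableSet S) :
    ∫⁻ a in U ⁻¹' S, w (U a) ∂μ ≤ lam.withDensity w S := by
  rw [← setLIntegral_map hS hw hU, withDensity_apply _ hS]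
  exact lintegral_mono' (Measure.restrict_mono le_rfl hle) le_rfl

theorem map_comp_le_of_measurePreserving {γ : Type*} [MeasurableSpace γ] {lam' : Measure γ}
    {f : β → γ} (hf : MeasurePreserving f lam lam') {U : α → β} (hU : Measurable U)
    (hle : μ.map U ≤ lam) : μ.map (fun a => f (U a)) ≤ lam' :=
  calc μ.map (fun a => f (U a)) = (μ.map U).map f := (Measure.map_map hf.measurable hU).symm
    _ ≤ lam.map f := Measure.map_mono hle hf.measurable
    _ = lam' := hf.map_eq

end Tilt

theorem pi_le_pow_smul_pi {ι : Type*} [Fintype ι] {α : ι → Type*} [∀ i, MeasurableSpace (α i)]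
    {μ ν : ∀ i, Measure (α i)} [∀ i, SigmaFinite (μ i)] {c : ℝ≥0∞}
    (hc : c ≠ 0) (hc' : c ≠ ⊤) (h : ∀ i, μ i ≤ c • ν i) :
    Measure.pi μ ≤ c ^ Fintype.card ι • Measure.pi ν := by
  have hn : c ^ Fintype.card ι ≠ 0 := pow_ne_zero _ hc
  have hn' : c ^ Fintype.card ι ≠ ⊤ := ENNReal.pow_ne_top hc'
  -- The outer measure of `Measure.pi ν` is the largest one bounded by `∏ i, ν i (s i)` on boxes.
  have hbox : ((c ^ Fintype.card ι)⁻¹ • Measure.pi μ).toOuterMeasure ≤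
      OuterMeasure.pi fun i => (ν i).toOuterMeasure := by
    refine OuterMeasure.le_pi.2 fun s _ => ?_
    rw [Measure.coe_toOuterMeasure, Measure.smul_apply, smul_eq_mul, Measure.pi_pi,
      ENNReal.inv_mul_le_iff hn hn']
    calc ∏ i, μ i (s i) ≤ ∏ i, c * ν i (s i) := Finset.prod_le_prod' fun i _ => h i (s i)
      _ = c ^ Fintype.card ι * ∏ i, ν i (s i) := by
        rw [Finset.prod_mul_distrib, Finset.prod_const, Finset.card_univ]
  refine Measure.le_iff.2 fun s hs => ?_
  rw [Measure.smul_apply, smul_eq_mul, ← ENNReal.inv_mul_le_iff hn hn']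
  exact (hbox s).trans_eq (by rw [Measure.pi, toMeasure_apply _ _ hs])

theorem gaussianReal_le_smul_volume (m : ℝ) {v : ℝ≥0} (hv : v ≠ 0) :
    gaussianReal m v ≤ ENNReal.ofReal (√(2 * Real.pi * v))⁻¹ • (volume : Measure ℝ) := by
  rw [gaussianReal_of_var_ne_zero m hv, ← withDensity_const]
  refine withDensity_mono (ae_of_all _ fun x => ENNReal.ofReal_le_ofReal ?_)
  refine mul_le_of_le_one_right (by positivity) (Real.exp_le_one_iff.2 ?_)
  exact div_nonpos_of_nonpos_of_nonneg (neg_nonpos.2 (sq_nonneg _)) (by positivity)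

theorem complexGaussian_le_smul_volume :
    complexGaussian ≤ ENNReal.ofReal Real.pi⁻¹ • (volume : Measure ℂ) := by
  have hequiv := Complex.volume_preserving_equiv_real_prod.symm
  have hprod : (gaussianReal 0 (1 / 2)).prod (gaussianReal 0 (1 / 2)) ≤
      ENNReal.ofReal Real.pi⁻¹ • (volume : Measure (ℝ × ℝ)) := by
    have hle := gaussianReal_le_smul_volume 0 (v := 1 / 2) (by norm_num)
    refine (Measure.prod_mono hle hle).trans_eq ?_
    rw [Measure.prod_smul_left, Measure.prod_smul_right, smul_smul,
      ← ENNReal.ofReal_mul (by positivity), ← mul_inv, Real.mul_self_sqrt (by positivity),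
      Measure.volume_eq_prod]
    congr 3
    push_cast
    ring
  refine (Measure.map_mono hprod hequiv.measurable).trans_eq ?_
  rw [Measure.map_smul, hequiv.map_eq]

instance : IsProbabilityMeasure complexGaussian :=
  Measure.isProbabilityMeasure_map Complex.measurableEquivRealProd.symm.measurable.aemeasurable

/-- The law of the noise at one receiver. -/
def receiverNoise (n : ℕ) : Measure (Signal n) := Measure.pi fun _ => complexGaussian

/-- Lebesgue measure on blocks of `n` symbols, scaled by `π ^ (-n)` so that receiver noise has a
density at most `1` with respect to it. -/
def scaledVolume (n : ℕ) : Measure (Signal n) := ENNReal.ofReal Real.pi⁻¹ ^ n • volume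

variable {n : ℕ}

instance : IsProbabilityMeasure (receiverNoise n) := by
  unfold receiverNoise; infer_instance

instance : IsProbabilityMeasure (noiseLaw n) := by
  unfold noiseLaw; infer_instance

instance : SFinite (scaledVolume n) := by
  unfold scaledVolume; infer_instance

instance : (scaledVolume n).IsAddRightInvariant := by
  unfold scaledVolume; infer_instance

theorem receiverNoise_le_scaledVolume : receiverNoise n ≤ scaledVolume n := by
  refine (pi_le_pow_smul_pi (by simp [Real.pi_pos]) ENNReal.ofReal_ne_top
    fun _ => complexGaussian_le_smul_volume).trans_eq ?_
  rw [Fintype.card_fin]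
  rfl

theorem measurePreserving_noiseLaw_pair {k l : Fin 2} (hkl : k ≠ l) :
    MeasurePreserving (fun z : Fin 2 → Signal n => (z k, z l)) (noiseLaw n)
      ((receiverNoise n).prod (receiverNoise n)) := by
  have h01 : MeasurePreserving (fun z : Fin 2 → Signal n => (z 0, z 1)) (noiseLaw n)
      ((receiverNoise n).prod (receiverNoise n)) := measurePreserving_finTwoArrow (receiverNoise n)
  obtain ⟨rfl, rfl⟩ | ⟨rfl, rfl⟩ : (k = 0 ∧ l = 1) ∨ (k = 1 ∧ l = 0) := by omega
  · exact h01
  · exact Measure.measurePreserving_swap.comp h01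

theorem map_noiseLaw_add_le (k : Fin 2) (a : Signal n) :
    (noiseLaw n).map (fun z => z k + a) ≤ scaledVolume n := by
  refine map_comp_le_of_measurePreserving (measurePreserving_add_right _ a)
    (measurable_pi_apply k) ?_
  exact (measurePreserving_eval (fun _ => receiverNoise n) k).map_eq.trans_le
    receiverNoise_le_scaledVolume

theorem map_noiseLaw_shear_le {k l : Fin 2} (hkl : k ≠ l) (a : Signal n) (ρ : ℂ) :
    (noiseLaw n).map (fun z => (z k + a, z l - ρ • z k)) ≤
      (scaledVolume n).prod (scaledVolume n) := by
  have hshear : MeasurePreserving (fun p : Signal n × Signal n => (p.1 + a, p.2 - ρ • p.1))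
      ((scaledVolume n).prod (scaledVolume n)) ((scaledVolume n).prod (scaledVolume n)) := by
    refine (measurePreserving_add_right (scaledVolume n) a).skew_product
      (g := fun x y => y - ρ • x) (by fun_prop) (ae_of_all _ fun x => ?_)
    simpa only [sub_eq_add_neg] using
      (measurePreserving_add_right (scaledVolume n) (-(ρ • x))).map_eq
  refine map_comp_le_of_measurePreserving hshear
    (measurePreserving_noiseLaw_pair hkl).measurable ?_
  exact (measurePreserving_noiseLaw_pair hkl).map_eq.trans_le
    (Measure.prod_mono receiverNoise_le_scaledVolume receiverNoise_le_scaledVolume)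

section Gaussian

variable {n : ℕ}

/-- The energy of a block of symbols. -/
def energy (x : Signal n) : ℝ := ∑ t, ‖x t‖ ^ 2

theorem energy_nonneg (x : Signal n) : 0 ≤ energy x := Finset.sum_nonneg fun _ _ => sq_nonneg _

@[fun_prop]
theorem measurable_energy : Measurable (energy : Signal n → ℝ) := by
  unfold energy; fun_prop

theorem energy_smul (a : ℂ) (x : Signal n) : energy (a • x) = ‖a‖ ^ 2 * energy x := by
  simp [energy, Finset.mul_sum, mul_pow]

theorem energy_add_le (x y : Signal n) : energy (x + y) ≤ 2 * energy x + 2 * energy y := by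
  simp only [energy, Finset.mul_sum, ← Finset.sum_add_distrib, ← mul_add]
  exact Finset.sum_le_sum fun t _ =>
    (pow_le_pow_left₀ (norm_nonneg _) (norm_add_le _ _) 2).trans add_sq_le

theorem energy_sub_le (x y : Signal n) : energy (x - y) ≤ 2 * energy x + 2 * energy y := by
  simpa [sub_eq_add_neg, energy] using energy_add_le x (-y)

/-- The code length, in nats and up to the additive constant `n * log π`, of a signal under the
circularly symmetric complex Gaussian law of power `s` per symbol. -/
def gaussianCost (s : ℝ) (y : Signal n) : ℝ := n * Real.log s + energy y / s

@[fun_prop]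
theorem measurable_gaussianCost (s : ℝ) : Measurable (gaussianCost s : Signal n → ℝ) := by
  unfold gaussianCost; fun_prop

variable (n) in
/-- The circularly symmetric complex Gaussian law of power `s` per symbol. -/
def gaussianLaw (s : ℝ) : Measure (Signal n) :=
  (scaledVolume n).withDensity fun y => ENNReal.ofReal (Real.exp (-gaussianCost s y))

theorem exp_neg_gaussianCost {s : ℝ} (hs : 0 < s) (y : Signal n) :
    Real.exp (-gaussianCost s y) = ∏ t, s⁻¹ * Real.exp (-s⁻¹ * ‖y t‖ ^ 2) := by
  rw [Finset.prod_mul_distrib, Finset.prod_const, ← Real.exp_sum, ← Finset.mul_sum, gaussianCost,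
    neg_add, Real.exp_add, Finset.card_univ, Fintype.card_fin, ← mul_neg, ← Real.log_inv,
    ← Real.log_pow, Real.exp_log (by positivity), energy, div_eq_inv_mul, neg_mul]

theorem integral_gaussianDensity {s : ℝ} (hs : 0 < s) :
    ∫ z : ℂ, s⁻¹ * Real.exp (-s⁻¹ * ‖z‖ ^ 2) = Real.pi := by
  rw [integral_const_mul, GaussianFourier.integral_rexp_neg_mul_sq_norm (inv_pos.2 hs)]
  simp [field]

theorem integrable_gaussianDensity {s : ℝ} (hs : 0 < s) :
    Integrable fun z : ℂ => s⁻¹ * Real.exp (-s⁻¹ * ‖z‖ ^ 2) :=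
  .of_integral_ne_zero (by rw [integral_gaussianDensity hs]; exact Real.pi_pos.ne')

theorem lintegral_exp_neg_gaussianCost {s : ℝ} (hs : 0 < s) :
    ∫⁻ y : Signal n, ENNReal.ofReal (Real.exp (-gaussianCost s y)) =
      ENNReal.ofReal Real.pi ^ n := by
  simp_rw [exp_neg_gaussianCost hs]
  rw [← ofReal_integral_eq_lintegral_ofReal, integral_fintype_prod_volume_eq_pow
    (fun z : ℂ => s⁻¹ * Real.exp (-s⁻¹ * ‖z‖ ^ 2)), integral_gaussianDensity hs,
    Fintype.card_fin, ENNReal.ofReal_pow Real.pi_pos.le]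
  · exact Integrable.fintype_prod (f := fun _ z => s⁻¹ * Real.exp (-s⁻¹ * ‖z‖ ^ 2))
      fun _ => integrable_gaussianDensity hs
  · exact ae_of_all _ fun y => Finset.prod_nonneg fun t _ => by positivity

theorem isProbabilityMeasure_gaussianLaw {s : ℝ} (hs : 0 < s) :
    IsProbabilityMeasure (gaussianLaw n s) := by
  constructor
  rw [gaussianLaw, withDensity_apply _ MeasurableSet.univ, Measure.restrict_univ, scaledVolume,
    lintegral_smul_measure, lintegral_exp_neg_gaussianCost hs, smul_eq_mul, ← mul_pow,
    ← ENNReal.ofReal_mul (by positivity), inv_mul_cancel₀ Real.pi_ne_zero, ENNReal.ofReal_one,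
    one_pow]

theorem gaussianLaw_prod (s t : ℝ) :
    (gaussianLaw n s).prod (gaussianLaw n t) =
      ((scaledVolume n).prod (scaledVolume n)).withDensity fun q =>
        ENNReal.ofReal (Real.exp (-(gaussianCost s q.1 + gaussianCost t q.2))) := by
  rw [gaussianLaw, gaussianLaw, prod_withDensity (by fun_prop) (by fun_prop)]
  simp only [neg_add, Real.exp_add, ENNReal.ofReal_mul (Real.exp_pos _).le]

theorem setLIntegral_noiseLaw_single_le (k : Fin 2) (s : ℝ) (a : Signal n) {S : Set (Signal n)}
    (hS : MeasurableSet S) :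
    ∫⁻ z in {z | z k + a ∈ S}, ENNReal.ofReal (Real.exp (-gaussianCost s (z k + a))) ∂noiseLaw n
      ≤ gaussianLaw n s S :=
  setLIntegral_preimage_comp_le_withDensity
    (w := fun y => ENNReal.ofReal (Real.exp (-gaussianCost s y)))
    (U := fun z : Fin 2 → Signal n => z k + a)
    (by fun_prop) (map_noiseLaw_add_le k a) (by fun_prop) hS

theorem setLIntegral_noiseLaw_pair_le {k l : Fin 2} (hkl : k ≠ l) (s t : ℝ) (a : Signal n)
    (ρ : ℂ) {S : Set (Signal n × Signal n)} (hS : MeasurableSet S) :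
    ∫⁻ z in {z | (z k + a, z l - ρ • z k) ∈ S}, ENNReal.ofReal (Real.exp
        (-(gaussianCost s (z k + a) + gaussianCost t (z l - ρ • z k)))) ∂noiseLaw n
      ≤ (gaussianLaw n s).prod (gaussianLaw n t) S := by
  rw [gaussianLaw_prod]
  exact setLIntegral_preimage_comp_le_withDensity
    (w := fun q => ENNReal.ofReal (Real.exp (-(gaussianCost s q.1 + gaussianCost t q.2))))
    (U := fun z : Fin 2 → Signal n => (z k + a, z l - ρ • z k))
    (by fun_prop) (map_noiseLaw_shear_le hkl a ρ) (by fun_prop) hS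

theorem integrable_sq_gaussianReal (v : ℝ≥0) : Integrable (fun x => x ^ 2) (gaussianReal 0 v) :=
  (memLp_id_gaussianReal 2).integrable_sq

theorem integral_sq_gaussianReal (v : ℝ≥0) : ∫ x, x ^ 2 ∂gaussianReal 0 v = v := by
  simpa using (variance_eq_integral (μ := gaussianReal 0 v) (X := id) aemeasurable_id).symm

theorem measurePreserving_complexGaussian :
    MeasurePreserving Complex.measurableEquivRealProd.symm
      ((gaussianReal 0 (1 / 2)).prod (gaussianReal 0 (1 / 2))) complexGaussian :=
  ⟨Complex.measurableEquivRealProd.symm.measurable, rfl⟩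

theorem sq_norm_measurableEquivRealProd_symm (p : ℝ × ℝ) :
    ‖Complex.measurableEquivRealProd.symm p‖ ^ 2 = p.1 ^ 2 + p.2 ^ 2 := by
  rw [Complex.sq_norm, Complex.normSq_apply, sq, sq]
  rfl

theorem integrable_sq_norm_complexGaussian :
    Integrable (fun z => ‖z‖ ^ 2) complexGaussian := by
  rw [← measurePreserving_complexGaussian.integrable_comp_emb
    (MeasurableEquiv.measurableEmbedding _)]
  simp only [Function.comp_def, sq_norm_measurableEquivRealProd_symm]
  exact ((integrable_sq_gaussianReal _).comp_fst _).add ((integrable_sq_gaussianReal _).comp_snd _)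

theorem integral_sq_norm_complexGaussian : ∫ z, ‖z‖ ^ 2 ∂complexGaussian = 1 := by
  rw [← measurePreserving_complexGaussian.integral_comp (MeasurableEquiv.measurableEmbedding _)]
  simp only [sq_norm_measurableEquivRealProd_symm]
  rw [integral_add ((integrable_sq_gaussianReal _).comp_fst _)
    ((integrable_sq_gaussianReal _).comp_snd _), integral_fun_fst (fun x : ℝ => x ^ 2),
    integral_fun_snd (fun x : ℝ => x ^ 2), integral_sq_gaussianReal]
  norm_num

theorem integrable_sq_norm_receiverNoise (t : Fin n) :
    Integrable (fun z => ‖z t‖ ^ 2) (receiverNoise n) :=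
  integrable_comp_eval (μ := fun _ => complexGaussian) integrable_sq_norm_complexGaussian

theorem integral_sq_norm_receiverNoise (t : Fin n) : ∫ z, ‖z t‖ ^ 2 ∂receiverNoise n = 1 :=
  (integral_comp_eval (μ := fun _ => complexGaussian) integrable_sq_norm_complexGaussian.1).trans
    integral_sq_norm_complexGaussian

theorem integrable_energy_receiverNoise : Integrable energy (receiverNoise n) :=
  integrable_finsetSum _ fun t _ => integrable_sq_norm_receiverNoise t

theorem integral_energy_receiverNoise : ∫ z, energy z ∂receiverNoise n = n := by
  simp only [energy]
  rw [integral_finsetSum _ fun t _ => integrable_sq_norm_receiverNoise t]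
  simp [integral_sq_norm_receiverNoise]

theorem integrable_energy_noiseLaw (k : Fin 2) :
    Integrable (fun z => energy (z k)) (noiseLaw n) :=
  integrable_comp_eval (μ := fun _ => receiverNoise n) integrable_energy_receiverNoise

theorem integral_energy_noiseLaw (k : Fin 2) : ∫ z, energy (z k) ∂noiseLaw n = n :=
  (integral_comp_eval (μ := fun _ => receiverNoise n) integrable_energy_receiverNoise.1).trans
    integral_energy_receiverNoise

end Gaussian

/-! ### The system -/

/-- The sample space of the system: the library, the channel and the noise of the two users. -/
abbrev Outcome (J L n : ℕ) : Type := Library J L × CSI × (Fin 2 → Signal n)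

section System

variable {J L n : ℕ} {ν : Measure ℂ} [IsProbabilityMeasure ν]

instance : IsProbabilityMeasure (csiLaw ν) := by
  unfold csiLaw; infer_instance

instance : IsProbabilityMeasure (systemLaw J L n ν) := by
  unfold systemLaw; infer_instance

theorem measurePreserving_systemLaw_csi :
    MeasurePreserving (fun ω : Outcome J L n => ω.2.1) (systemLaw J L n ν) (csiLaw ν) :=
  measurePreserving_fst.comp measurePreserving_snd

theorem measurePreserving_systemLaw_noise :
    MeasurePreserving (fun ω : Outcome J L n => ω.2.2) (systemLaw J L n ν) (noiseLaw n) :=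
  measurePreserving_snd.comp measurePreserving_snd

theorem measurePreserving_systemLaw_library_csi :
    MeasurePreserving (fun ω : Outcome J L n => (ω.1, ω.2.1)) (systemLaw J L n ν)
      ((libraryLaw J L).prod (csiLaw ν)) :=
  (MeasurePreserving.id _).prod measurePreserving_fst

theorem lintegral_systemLaw {f : Outcome J L n → ℝ≥0∞} (hf : Measurable f) :
    ∫⁻ ω, f ω ∂systemLaw J L n ν =
      ∫⁻ g, ∫⁻ F, ∫⁻ z, f (F, g, z) ∂noiseLaw n ∂libraryLaw J L ∂csiLaw ν := by
  have hinner : Measurable fun p : Library J L × CSI => ∫⁻ z, f (p.1, p.2, z) ∂noiseLaw n :=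
    Measurable.lintegral_prod_right' (f := fun q : (Library J L × CSI) × (Fin 2 → Signal n) =>
      f (q.1.1, q.1.2, q.2)) (by fun_prop)
  rw [systemLaw, lintegral_prod _ hf.aemeasurable]
  refine (lintegral_congr fun F => ?_).trans (lintegral_lintegral_swap hinner.aemeasurable)
  exact lintegral_prod (fun x => f (F, x)) (hf.comp measurable_prodMk_left).aemeasurable

variable {V : Library J L → CSI → ℕ} (hV : ∀ F, Measurable (V F))
include hV

theorem measurable_surprisal_library :
    Measurable fun p : Library J L × CSI => surprisal (libraryLaw J L) (V · p.2) p.1 :=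
  measurable_from_prod_countable_right fun F => measurable_surprisal_of_forall _ hV F

theorem measurable_surprisal_systemLaw :
    Measurable fun ω : Outcome J L n => surprisal (libraryLaw J L) (V · ω.2.1) ω.1 :=
  (measurable_surprisal_library hV).comp
    (g := fun p : Library J L × CSI => surprisal (libraryLaw J L) (V · p.2) p.1)
    (f := fun ω : Outcome J L n => (ω.1, ω.2.1)) (by fun_prop)

theorem integrable_surprisal_library_csi :
    Integrable (fun p : Library J L × CSI => surprisal (libraryLaw J L) (V · p.2) p.1)
      ((libraryLaw J L).prod (csiLaw ν)) :=
  .of_bound (measurable_surprisal_library hV).aestronglyMeasurable _ <| ae_of_all _ fun p => by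
    rw [Real.norm_of_nonneg (surprisal_nonneg (libraryLaw J L) _ _)]
    exact surprisal_libraryLaw_le (V · p.2) p.1

theorem integrable_surprisal_systemLaw :
    Integrable (fun ω : Outcome J L n => surprisal (libraryLaw J L) (V · ω.2.1) ω.1)
      (systemLaw J L n ν) :=
  measurePreserving_systemLaw_library_csi.integrable_comp_of_integrable
    (integrable_surprisal_library_csi hV)

theorem integral_surprisal_systemLaw :
    ∫ ω : Outcome J L n, surprisal (libraryLaw J L) (V · ω.2.1) ω.1 ∂systemLaw J L n ν =
      (∫ g, entropy (libraryLaw J L) (V · g) ∂csiLaw ν) * Real.log 2 := by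
  have hproj := measurePreserving_systemLaw_library_csi (J := J) (L := L) (n := n) (ν := ν)
  calc ∫ ω : Outcome J L n, surprisal (libraryLaw J L) (V · ω.2.1) ω.1 ∂systemLaw J L n ν
      = ∫ p, surprisal (libraryLaw J L) (V · p.2) p.1 ∂(libraryLaw J L).prod (csiLaw ν) := by
        rw [← hproj.map_eq, integral_map hproj.measurable.aemeasurable
          (measurable_surprisal_library hV).aestronglyMeasurable]
    _ = (∫ g, entropy (libraryLaw J L) (V · g) ∂csiLaw ν) * Real.log 2 := by
        rw [integral_prod_symm _ (integrable_surprisal_library_csi hV), ← integral_mul_const]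
        simp only [integral_surprisal]

end System

namespace Policy

section Decoding

variable {J L : ℕ} (π : Policy J L) (D : Demand J)

section Measurability

variable {α : Type*} [MeasurableSpace α] {F : α → Library J L} {g : α → CSI}

@[fun_prop]
theorem measurable_codeword (m : Fin 2) (hF : Measurable F) (hg : Measurable g) :
    Measurable fun a => π.codeword m D (F a) (g a) := by
  have hedge : ∀ F : Library J L, Measurable fun p : ℕ × CSI =>
      π.edge m D (fun j => π.cache m j (F j)) p.1 p.2 := fun F =>
    measurable_from_prod_countable_right fun u => π.measurable_edge m D _ u
  have hcodeword : Measurable fun p : Library J L × CSI => π.codeword m D p.1 p.2 :=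
    measurable_from_prod_countable_right fun F =>
      (hedge F).comp ((π.measurable_fronthaul m D F).prodMk measurable_id)
  exact hcodeword.comp (hF.prodMk hg)

@[fun_prop]
theorem measurable_decode_comp (k : Fin 2) {y : α → Signal (π.edgeTime D)} (hy : Measurable y)
    (hg : Measurable g) : Measurable fun a => π.decode k D (y a) (g a) :=
  (π.measurable_decode k D).comp (hy.prodMk hg)

end Measurability

/-- The signal `∑ m, H_{m,k} X_m` that reaches user `k`, before the noise. -/
def noiseless (k : Fin 2) (F : Library J L) (g : CSI) : Signal (π.edgeTime D) :=
  ∑ m, g m k • π.codeword m D F g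

theorem received_eq (k : Fin 2) (F : Library J L) (g : CSI) (z : Fin 2 → Signal (π.edgeTime D)) :
    π.received k D F g z = z k + π.noiseless D k F g := by
  funext t
  simp [received, noiseless, add_comm]

@[fun_prop]
theorem measurable_noiseless {α : Type*} [MeasurableSpace α] {F : α → Library J L}
    {g : α → CSI} (k : Fin 2) (hF : Measurable F) (hg : Measurable g) :
    Measurable fun a => π.noiseless D k (F a) (g a) := by
  unfold noiseless
  fun_prop

/-- The event that every user in `A` decodes its requested file. -/
def success (A : Finset (Fin 2)) : Set (Outcome J L (π.edgeTime D)) :=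
  {ω | ∀ k ∈ A, π.decode k D (ω.2.2 k + π.noiseless D k ω.1 ω.2.1) ω.2.1 = ω.1 (D k)}

theorem measurableSet_success (A : Finset (Fin 2)) : MeasurableSet (π.success D A) := by
  have hdecode (k : Fin 2) : Measurable fun ω : Outcome J L (π.edgeTime D) =>
      π.decode k D (ω.2.2 k + π.noiseless D k ω.1 ω.2.1) ω.2.1 := by fun_prop
  have hfile (k : Fin 2) : Measurable fun ω : Outcome J L (π.edgeTime D) => ω.1 (D k) := by
    fun_prop
  exact Measurable.setOf (Measurable.forall fun k => Measurable.imp measurable_const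
    (measurableSet_setOfPred.1 (measurableSet_eq_fun (hdecode k) (hfile k))))

variable (ν : Measure ℂ)

theorem errorProb_le_maxErrorProb (k : Fin 2) : π.errorProb ν D k ≤ π.maxErrorProb ν :=
  (le_ciSup (f := fun k => π.errorProb ν D k) (Set.finite_range _).bddAbove k).trans
    (le_ciSup (f := fun D => ⨆ k, π.errorProb ν D k) (Set.finite_range _).bddAbove D)

variable {ν} [IsProbabilityMeasure ν] (A : Finset (Fin 2)) {G : Set CSI} (hG : MeasurableSet G)
include hG

theorem csiLaw_real_sub_le_success :
    (csiLaw ν).real G - A.card * π.maxErrorProb ν ≤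
      (systemLaw J L (π.edgeTime D) ν).real ({ω | ω.2.1 ∈ G} ∩ π.success D A) := by
  let error (k : Fin 2) : Set (Outcome J L (π.edgeTime D)) :=
    {ω | π.decode k D (π.received k D ω.1 ω.2.1 ω.2.2) ω.2.1 ≠ ω.1 (D k)}
  have hcover : {ω : Outcome J L (π.edgeTime D) | ω.2.1 ∈ G} ⊆
      ({ω | ω.2.1 ∈ G} ∩ π.success D A) ∪ ⋃ k ∈ A, error k := fun ω hω => by
    simp only [Set.mem_union, Set.mem_inter_iff, Set.mem_iUnion, success, error, received_eq,
      Set.mem_ofPred_eq]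
    grind
  have herror : (systemLaw J L (π.edgeTime D) ν).real (⋃ k ∈ A, error k) ≤
      A.card * π.maxErrorProb ν := by
    refine (measureReal_biUnion_finset_le _ _).trans ?_
    rw [← nsmul_eq_mul]
    exact Finset.sum_le_card_nsmul _ _ _ fun k _ => π.errorProb_le_maxErrorProb D ν k
  have hmass := (measureReal_mono hcover (μ := systemLaw J L (π.edgeTime D) ν)).trans
    (measureReal_union_le _ _)
  have hcsi : (systemLaw J L (π.edgeTime D) ν).real {ω | ω.2.1 ∈ G} = (csiLaw ν).real G :=
    measurePreserving_systemLaw_csi.measureReal_preimage hG.nullMeasurableSet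
  linarith

variable {ι Y : Type*} [Fintype ι] [MeasurableSpace Y] {V : ι → Library J L → CSI → ℕ}
  {c : Outcome J L (π.edgeTime D) → ℝ} {S : CSI → Library J L → Set Y}

theorem setLIntegral_success_le (hV : ∀ i F, Measurable (V i F)) (hc : Measurable c)
    (Q : Measure Y) [IsProbabilityMeasure Q] (hS : ∀ g F, MeasurableSet (S g F))
    (htilt : ∀ g ∈ G, ∀ F, ∫⁻ z in {z | (F, g, z) ∈ π.success D A},
      ENNReal.ofReal (Real.exp (-c (F, g, z))) ∂noiseLaw (π.edgeTime D) ≤ Q (S g F))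
    (hres : ∀ g ∈ G, Resolves (A.map D) (fun i F => V i F g) (S g)) :
    ∫⁻ ω in {ω | ω.2.1 ∈ G} ∩ π.success D A, ENNReal.ofReal (Real.exp
        (-(∑ i, surprisal (libraryLaw J L) (V i · ω.2.1) ω.1 + c ω)))
        ∂systemLaw J L (π.edgeTime D) ν
      ≤ ENNReal.ofReal ((2 : ℝ) ^ (L * A.card))⁻¹ := by
  have hT : MeasurableSet (π.success D A) := π.measurableSet_success D A
  have hC : MeasurableSet ({ω : Outcome J L (π.edgeTime D) | ω.2.1 ∈ G} ∩ π.success D A) :=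
    ((measurePreserving_systemLaw_csi (ν := ν)).measurable hG).inter hT
  have hcode : Measurable fun ω : Outcome J L (π.edgeTime D) =>
      ∑ i, surprisal (libraryLaw J L) (V i · ω.2.1) ω.1 :=
    Finset.measurable_sum _ fun i _ => measurable_surprisal_systemLaw (hV i)
  have hweight := (hcode.add hc).neg.exp.ennreal_ofReal.indicator hC
  rw [← lintegral_indicator hC]
  refine (lintegral_systemLaw hweight).trans_le ?_
  refine (lintegral_mono fun g => ?_).trans_eq (by rw [lintegral_const, measure_univ, mul_one])
  by_cases hg : g ∈ G
  · refine le_trans (lintegral_mono fun F => ?_)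
      (((hres g hg).lintegral_setLIntegral_le Q (hS g) (htilt g hg)).trans_eq
        (by rw [Finset.card_map]))
    have hTF : MeasurableSet {z | (F, g, z) ∈ π.success D A} :=
      measurable_prodMk_left (measurable_prodMk_left hT)
    rw [← lintegral_indicator hTF]
    refine lintegral_mono fun z => ?_
    by_cases hz : (F, g, z) ∈ π.success D A <;> simp [hg, hz]
  · simp [hg]

theorem success_mul_log_le (hV : ∀ i F, Measurable (V i F)) (hc : Measurable c)
    (hcint : Integrable c (systemLaw J L (π.edgeTime D) ν)) (hc0 : 0 ≤ c)
    (Q : Measure Y) [IsProbabilityMeasure Q] (hS : ∀ g F, MeasurableSet (S g F))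
    (htilt : ∀ g ∈ G, ∀ F, ∫⁻ z in {z | (F, g, z) ∈ π.success D A},
      ENNReal.ofReal (Real.exp (-c (F, g, z))) ∂noiseLaw (π.edgeTime D) ≤ Q (S g F))
    (hres : ∀ g ∈ G, Resolves (A.map D) (fun i F => V i F g) (S g)) :
    ((csiLaw ν).real G - A.card * π.maxErrorProb ν) * (A.card * (L * Real.log 2)) ≤
      1 + ((∑ i, ∫ g, entropy (libraryLaw J L) (V i · g) ∂csiLaw ν) * Real.log 2
        + ∫ ω, c ω ∂systemLaw J L (π.edgeTime D) ν) := by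
  have hcode := fun i => integrable_surprisal_systemLaw (n := π.edgeTime D) (ν := ν) (hV i)
  have hsum := integrable_finsetSum Finset.univ fun i _ => hcode i
  have hlog : Real.log (2 ^ (L * A.card)) = A.card * (L * Real.log 2) := by
    rw [Real.log_pow]; push_cast; ring
  have hmain := measureReal_mul_log_le_one_add_integral (by positivity) (hsum.add hcint)
    (fun ω => add_nonneg (Finset.sum_nonneg fun _ _ => surprisal_nonneg _ _ _) (hc0 ω))
    (π.setLIntegral_success_le D A hG hV hc Q hS htilt hres)
  simp only [Pi.add_apply] at hmain
  rw [integral_add hsum hcint, integral_finsetSum _ fun i _ => hcode i, hlog] at hmain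
  simp only [integral_surprisal_systemLaw (hV _), ← Finset.sum_mul] at hmain
  refine (mul_le_mul_of_nonneg_right (π.csiLaw_real_sub_le_success D A hG) ?_).trans hmain
  positivity

end Decoding

end Policy

/-- The channel states whose coefficients have moduli between `1 / K` and `K`. -/
def boundedCSI (K : ℝ) : Set CSI := {g | ∀ m k, ‖g m k‖ ≤ K ∧ 1 ≤ K * ‖g m k‖}

theorem measurableSet_boundedCSI (K : ℝ) : MeasurableSet (boundedCSI K) := by
  have hInter : boundedCSI K = ⋂ m, ⋂ k,
      ({g : CSI | ‖g m k‖ ≤ K} ∩ {g : CSI | 1 ≤ K * ‖g m k‖}) := by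
    ext; simp [boundedCSI]
  rw [hInter]
  exact MeasurableSet.iInter fun m => MeasurableSet.iInter fun k =>
    (measurableSet_le (by fun_prop) (by fun_prop)).inter
      (measurableSet_le (by fun_prop) (by fun_prop))

theorem ne_zero_of_mem_boundedCSI {K : ℝ} {g : CSI} (hg : g ∈ boundedCSI K) (m k : Fin 2) :
    g m k ≠ 0 := fun h0 => by
  have := (hg m k).2
  rw [h0, norm_zero, mul_zero] at this
  linarith

theorem norm_div_le_of_mem_boundedCSI {K : ℝ} {g : CSI} (hg : g ∈ boundedCSI K) (m k l : Fin 2) :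
    ‖g m l / g m k‖ ≤ K ^ 2 := by
  have hpos : 0 < ‖g m k‖ := norm_pos_iff.2 (ne_zero_of_mem_boundedCSI hg m k)
  have hK : 0 ≤ K := (norm_nonneg _).trans (hg m k).1
  rw [norm_div, div_le_iff₀ hpos]
  calc ‖g m l‖ ≤ K * 1 := by simpa using (hg m l).1
    _ ≤ K * (K * ‖g m k‖) := by gcongr; exact (hg m k).2
    _ = K ^ 2 * ‖g m k‖ := by ring

section Residual

variable {J L n : ℕ}

/-- An upper bound for the Gaussian cost of the difference of the noise at user `l` and a multiple
of the noise at user `k` by a factor of modulus at most `B`. -/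
def residualCost (B : ℝ) (k l : Fin 2) (ω : Outcome J L n) : ℝ :=
  2 * energy (ω.2.2 l) + 2 * B ^ 2 * energy (ω.2.2 k)

theorem gaussianCost_residual_le {B : ℝ} {ρ : ℂ} (hρ : ‖ρ‖ ≤ B) (k l : Fin 2)
    (F : Library J L) (g : CSI) (z : Fin 2 → Signal n) :
    gaussianCost 1 (z l - ρ • z k) ≤ residualCost B k l (F, g, z) := by
  have hsmul : energy (ρ • z k) ≤ B ^ 2 * energy (z k) := by
    rw [energy_smul]
    exact mul_le_mul_of_nonneg_right (pow_le_pow_left₀ (norm_nonneg _) hρ 2) (energy_nonneg _)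
  simp only [gaussianCost, Real.log_one, mul_zero, zero_add, div_one, residualCost]
  linarith [energy_sub_le (z l) (ρ • z k)]

@[fun_prop]
theorem measurable_residualCost (B : ℝ) (k l : Fin 2) :
    Measurable (residualCost B k l : Outcome J L n → ℝ) := by
  unfold residualCost; fun_prop

theorem residualCost_nonneg (B : ℝ) (k l : Fin 2) :
    0 ≤ (residualCost B k l : Outcome J L n → ℝ) := fun ω => by
  have hk := energy_nonneg (ω.2.2 k)
  have hl := energy_nonneg (ω.2.2 l)
  unfold residualCost
  positivity

variable {ν : Measure ℂ} [IsProbabilityMeasure ν]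

theorem integrable_noise_energy (k : Fin 2) :
    Integrable (fun ω : Outcome J L n => energy (ω.2.2 k)) (systemLaw J L n ν) :=
  measurePreserving_systemLaw_noise.integrable_comp_of_integrable (integrable_energy_noiseLaw k)

theorem integral_noise_energy (k : Fin 2) :
    ∫ ω : Outcome J L n, energy (ω.2.2 k) ∂systemLaw J L n ν = n := by
  have hproj := measurePreserving_systemLaw_noise (J := J) (L := L) (n := n) (ν := ν)
  have hmeas : Measurable fun z : Fin 2 → Signal n => energy (z k) := by fun_prop
  rw [← integral_energy_noiseLaw (n := n) k, ← hproj.map_eq,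
    integral_map hproj.measurable.aemeasurable hmeas.aestronglyMeasurable]

theorem integrable_residualCost (B : ℝ) (k l : Fin 2) :
    Integrable (residualCost B k l : Outcome J L n → ℝ) (systemLaw J L n ν) :=
  ((integrable_noise_energy l).const_mul _).add ((integrable_noise_energy k).const_mul _)

theorem integral_residualCost (B : ℝ) (k l : Fin 2) :
    ∫ ω : Outcome J L n, residualCost B k l ω ∂systemLaw J L n ν = n * (2 + 2 * B ^ 2) := by
  simp only [residualCost]
  rw [integral_add ((integrable_noise_energy l).const_mul _)
    ((integrable_noise_energy k).const_mul _), integral_const_mul, integral_const_mul,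
    integral_noise_energy, integral_noise_energy]
  ring

end Residual

namespace Policy

variable {J L : ℕ} {π : Policy J L} {ν : Measure ℂ} [IsProbabilityMeasure ν]

theorem CacheConstraint.entropy_mul_log_le {μ : Fin 2 → Fin J → ℝ} (h : π.CacheConstraint μ)
    (m : Fin 2) (j : Fin J) :
    entropy (libraryLaw J L) (fun F => π.cache m j (F j)) * Real.log 2
      ≤ μ m j * (L * Real.log 2) := by
  rw [← mul_assoc]
  gcongr
  exact h m j

theorem FronthaulConstraint.integral_entropy_mul_log_le {ν : Measure ℂ} {r P : ℝ}
    (h : π.FronthaulConstraint ν r P) (D : Demand J) (m : Fin 2) :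
    (∫ g, entropy (libraryLaw J L) (fun F => π.fronthaul m D F g) ∂csiLaw ν) * Real.log 2
      ≤ r * (π.fronthaulTime D * Real.log P) := by
  calc (∫ g, entropy (libraryLaw J L) (fun F => π.fronthaul m D F g) ∂csiLaw ν) * Real.log 2
      ≤ r * Real.logb 2 P * π.fronthaulTime D * Real.log 2 := by gcongr; exact h m D
    _ = r * (π.fronthaulTime D * Real.log P) := by
        rw [Real.logb]; field_simp

section Power

variable {P : ℝ} (hP : 0 ≤ P) (h : π.PowerConstraint ν P) (m : Fin 2) (D : Demand J)
include h

theorem PowerConstraint.integrable_energy_codeword :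
    Integrable (fun ω : Outcome J L (π.edgeTime D) => energy (π.codeword m D ω.1 ω.2.1))
      (systemLaw J L (π.edgeTime D) ν) := by
  have hmeas : Measurable fun p : Library J L × CSI => energy (π.codeword m D p.1 p.2) := by
    fun_prop
  have hint : Integrable (fun p => energy (π.codeword m D p.1 p.2))
      ((libraryLaw J L).prod (csiLaw ν)) :=
    ⟨hmeas.aestronglyMeasurable,
      (hasFiniteIntegral_iff_ofReal (ae_of_all _ fun _ => energy_nonneg _)).2
        ((h m D).trans_lt ENNReal.ofReal_lt_top)⟩
  exact measurePreserving_systemLaw_library_csi.integrable_comp_of_integrable hint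

include hP in
theorem PowerConstraint.integral_energy_codeword_le :
    ∫ ω : Outcome J L (π.edgeTime D), energy (π.codeword m D ω.1 ω.2.1)
      ∂systemLaw J L (π.edgeTime D) ν ≤ π.edgeTime D * P := by
  rw [integral_eq_lintegral_of_nonneg_ae (ae_of_all _ fun _ => energy_nonneg _)
    (h.integrable_energy_codeword m D).1]
  refine ENNReal.toReal_le_of_le_ofReal (by positivity) ?_
  exact (measurePreserving_systemLaw_library_csi.lintegral_comp (f := fun p : Library J L × CSI =>
    ENNReal.ofReal (energy (π.codeword m D p.1 p.2))) (by fun_prop)).trans_le (h m D)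

end Power

section Converse

variable (π) (D : Demand J)

theorem energy_noiseless_le {K : ℝ} {g : CSI} (hg : ∀ m k, ‖g m k‖ ≤ K) (k : Fin 2)
    (F : Library J L) :
    energy (π.noiseless D k F g) ≤ 2 * K ^ 2 * ∑ m, energy (π.codeword m D F g) := by
  have hsmul (m : Fin 2) : energy (g m k • π.codeword m D F g) ≤
      K ^ 2 * energy (π.codeword m D F g) := by
    rw [energy_smul]
    exact mul_le_mul_of_nonneg_right (pow_le_pow_left₀ (norm_nonneg _) (hg m k) 2)
      (energy_nonneg _)
  rw [noiseless, Fin.sum_univ_two, Fin.sum_univ_two]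
  linarith [energy_add_le (g 0 k • π.codeword 0 D F g) (g 1 k • π.codeword 1 D F g), hsmul 0,
    hsmul 1]

/-- An upper bound for the Gaussian cost of the signal received by user `k` that is valid when the
channel coefficients are at most `K` in modulus, and integrable over all channel states. -/
def receivedCost (K P : ℝ) (k : Fin 2) (ω : Outcome J L (π.edgeTime D)) : ℝ :=
  π.edgeTime D * Real.log P
    + (2 * energy (ω.2.2 k) + 4 * K ^ 2 * ∑ m, energy (π.codeword m D ω.1 ω.2.1)) / P

theorem gaussianCost_received_le {K P : ℝ} (hP : 0 < P) {g : CSI} (hg : ∀ m k, ‖g m k‖ ≤ K)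
    (k : Fin 2) (F : Library J L) (z : Fin 2 → Signal (π.edgeTime D)) :
    gaussianCost P (z k + π.noiseless D k F g) ≤ π.receivedCost D K P k (F, g, z) := by
  unfold gaussianCost receivedCost
  gcongr
  linarith [energy_add_le (z k) (π.noiseless D k F g), π.energy_noiseless_le D hg k F]

@[fun_prop]
theorem measurable_receivedCost (K P : ℝ) (k : Fin 2) : Measurable (π.receivedCost D K P k) := by
  unfold receivedCost; fun_prop

theorem receivedCost_nonneg {P : ℝ} (hP : 1 ≤ P) (K : ℝ) (k : Fin 2) :
    0 ≤ π.receivedCost D K P k := fun ω => by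
  have hlog := Real.log_nonneg hP
  have hnoise := energy_nonneg (ω.2.2 k)
  have hcodeword := Finset.sum_nonneg fun m (_ : m ∈ Finset.univ) =>
    energy_nonneg (π.codeword m D ω.1 ω.2.1)
  unfold receivedCost
  positivity

variable {π} {P : ℝ}

theorem PowerConstraint.integrable_receivedCost (hpow : π.PowerConstraint ν P) (K : ℝ)
    (k : Fin 2) : Integrable (π.receivedCost D K P k) (systemLaw J L (π.edgeTime D) ν) :=
  (integrable_const _).add ((((integrable_noise_energy k).const_mul _).add
    ((integrable_finsetSum _ fun m _ => hpow.integrable_energy_codeword m D).const_mul _)).div_const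
      _)

theorem PowerConstraint.integral_receivedCost (hpow : π.PowerConstraint ν P) (K : ℝ)
    (k : Fin 2) :
    ∫ ω, π.receivedCost D K P k ω ∂systemLaw J L (π.edgeTime D) ν =
      π.edgeTime D * Real.log P + (2 * π.edgeTime D + 4 * K ^ 2 * ∑ m,
        ∫ ω : Outcome J L (π.edgeTime D), energy (π.codeword m D ω.1 ω.2.1)
          ∂systemLaw J L (π.edgeTime D) ν) / P := by
  have hcodeword := fun m (_ : m ∈ Finset.univ) => hpow.integrable_energy_codeword m D
  have hnoise : Integrable (fun ω : Outcome J L (π.edgeTime D) => 2 * energy (ω.2.2 k))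
      (systemLaw J L (π.edgeTime D) ν) := (integrable_noise_energy k).const_mul 2
  have hsignal := (integrable_finsetSum _ hcodeword).const_mul (4 * K ^ 2)
  have henergy : Integrable (fun ω : Outcome J L (π.edgeTime D) => 2 * energy (ω.2.2 k)
      + 4 * K ^ 2 * ∑ m, energy (π.codeword m D ω.1 ω.2.1)) (systemLaw J L (π.edgeTime D) ν) :=
    hnoise.add hsignal
  simp only [receivedCost]
  rw [integral_add (integrable_const _) (henergy.div_const P), integral_const, probReal_univ,
    one_smul, integral_div, integral_add hnoise hsignal, integral_const_mul, integral_const_mul,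
    integral_finsetSum _ hcodeword, integral_noise_energy]

theorem PowerConstraint.integral_receivedCost_le (hP : 1 ≤ P) (hpow : π.PowerConstraint ν P)
    (K : ℝ) (k : Fin 2) :
    ∫ ω, π.receivedCost D K P k ω ∂systemLaw J L (π.edgeTime D) ν
      ≤ π.edgeTime D * (Real.log P + (2 + 8 * K ^ 2)) := by
  have hP0 : 0 < P := one_pos.trans_le hP
  rw [hpow.integral_receivedCost, mul_add _ (Real.log P)]
  gcongr
  rw [div_le_iff₀ hP0]
  calc 2 * (π.edgeTime D : ℝ) + 4 * K ^ 2 * ∑ m,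
        ∫ ω : Outcome J L (π.edgeTime D), energy (π.codeword m D ω.1 ω.2.1)
          ∂systemLaw J L (π.edgeTime D) ν
      ≤ 2 * (π.edgeTime D * P) + 4 * K ^ 2 * ∑ _m : Fin 2, (π.edgeTime D * P) := by
        gcongr with m
        · exact le_mul_of_one_le_right (Nat.cast_nonneg _) hP
        · exact hpow.integral_energy_codeword_le hP0.le m D
    _ = π.edgeTime D * (2 + 8 * K ^ 2) * P := by
        rw [Fin.sum_univ_two]; ring

end Converse

end Policy

/-! ### Converse bounds -/

namespace Policy

variable {J L : ℕ} (π : Policy J L) (D : Demand J)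

theorem codeword_congr {I : Finset (Fin J)} {m : Fin 2} {F F' : Library J L} {g : CSI}
    (hrest : ∀ j ∉ I, F j = F' j) (hcache : ∀ j ∈ I, π.cache m j (F j) = π.cache m j (F' j))
    (hfront : π.fronthaul m D F g = π.fronthaul m D F' g) :
    π.codeword m D F g = π.codeword m D F' g := by
  have hall (j : Fin J) : π.cache m j (F j) = π.cache m j (F' j) :=
    if hj : j ∈ I then hcache j hj else congrArg _ (hrest j hj)
  rw [codeword, codeword, hfront, funext hall]

theorem measurableSet_decode_eq (k : Fin 2) (g : CSI) (f : File L) :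
    MeasurableSet {y | π.decode k D y g = f} :=
  ((π.measurable_decode k D).comp measurable_prodMk_right) (measurableSet_singleton f)

section Edge

theorem resolves_decode (k : Fin 2) (g : CSI) :
    Resolves (Finset.map D {k}) (fun (i : Empty) _ => i.elim)
      (fun F : Library J L => {y | π.decode k D y g = F (D k)}) := fun _ F F' hF hF' _ _ j hj => by
  obtain rfl : j = D k := by simpa using hj
  exact Eq.trans (Eq.symm hF) hF'

theorem setLIntegral_success_single_le {K P : ℝ} (hP : 0 < P) {g : CSI} (hg : g ∈ boundedCSI K)
    (k : Fin 2) (F : Library J L) :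
    ∫⁻ z in {z | (F, g, z) ∈ π.success D {k}},
        ENNReal.ofReal (Real.exp (-π.receivedCost D K P k (F, g, z))) ∂noiseLaw (π.edgeTime D)
      ≤ gaussianLaw (π.edgeTime D) P {y | π.decode k D y g = F (D k)} := by
  refine le_trans ?_ (setLIntegral_noiseLaw_single_le k P (π.noiseless D k F g)
    (π.measurableSet_decode_eq D k g _))
  refine lintegral_mono' (Measure.restrict_mono (fun z hz => ?_) le_rfl) fun z => ?_
  · exact hz k (Finset.mem_singleton_self k)
  · gcongr
    exact π.gaussianCost_received_le D hP (fun m k => (hg m k).1) k F z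

variable {π} {ν : Measure ℂ} [IsProbabilityMeasure ν]

theorem edge_converse {P : ℝ} (hP : 1 ≤ P) (hpow : π.PowerConstraint ν P) (K : ℝ) (k : Fin 2) :
    ((csiLaw ν).real (boundedCSI K) - π.maxErrorProb ν) * (L * Real.log 2) ≤
      1 + (π.edgeTime D * Real.log P + π.edgeTime D * (2 + 8 * K ^ 2)) := by
  have hP0 : 0 < P := one_pos.trans_le hP
  have := isProbabilityMeasure_gaussianLaw (n := π.edgeTime D) hP0
  have hcount := π.success_mul_log_le D {k} (measurableSet_boundedCSI K)
    (V := fun (i : Empty) _ _ => i.elim) (fun i => i.elim) (by fun_prop)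
    (hpow.integrable_receivedCost D K k) (π.receivedCost_nonneg D hP K k)
    (gaussianLaw (π.edgeTime D) P) (fun g F => π.measurableSet_decode_eq D k g (F (D k)))
    (fun g hg => π.setLIntegral_success_single_le D hP0 hg k)
    (fun g _ => π.resolves_decode D k g)
  have hcost := hpow.integral_receivedCost_le D hP K k
  simp only [Finset.card_singleton, Nat.cast_one, one_mul, Finset.univ_eq_empty,
    Finset.sum_empty, zero_mul, zero_add] at hcount
  linarith

end Edge

section Fronthaul

/-- The fronthaul messages, and what the ENs cache of the files requested by the users in `A`. -/
def networkMessages (A : Finset (Fin 2)) : Fin 2 ⊕ Fin 2 × A → Library J L → CSI → ℕ :=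
  Sum.elim (fun m => π.fronthaul m D) fun i F _ => π.cache i.1 (D i.2) (F (D i.2))

theorem measurable_networkMessages (A : Finset (Fin 2)) (i : Fin 2 ⊕ Fin 2 × A)
    (F : Library J L) : Measurable (π.networkMessages D A i F) := by
  rcases i with m | i
  · exact π.measurable_fronthaul m D F
  · exact measurable_const

theorem resolves_networkMessages (A : Finset (Fin 2)) (g : CSI) :
    Resolves (A.map D) (fun i F => π.networkMessages D A i F g)
      (fun F => {z | (F, g, z) ∈ π.success D A}) := fun z F F' hF hF' hrest hV => by
  have hcodeword (m : Fin 2) : π.codeword m D F g = π.codeword m D F' g := by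
    refine π.codeword_congr D hrest (fun j hj => ?_) (hV (Sum.inl m))
    obtain ⟨k, hk, rfl⟩ := Finset.mem_map.1 hj
    exact hV (Sum.inr (m, ⟨k, hk⟩))
  have hnoiseless (k : Fin 2) : π.noiseless D k F g = π.noiseless D k F' g := by
    simp only [noiseless, hcodeword]
  intro j hj
  obtain ⟨k, hk, rfl⟩ := Finset.mem_map.1 hj
  have hdecode : π.decode k D (z k + π.noiseless D k F g) g = F (D k) := hF k hk
  rw [hnoiseless k] at hdecode
  exact hdecode.symm.trans (hF' k hk)

variable {π} {ν : Measure ℂ} [IsProbabilityMeasure ν]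

theorem fronthaul_converse {r P : ℝ} {μ : Fin 2 → Fin J → ℝ} (hcache : π.CacheConstraint μ)
    (hfront : π.FronthaulConstraint ν r P) (A : Finset (Fin 2)) :
    (1 - A.card * π.maxErrorProb ν) * (A.card * (L * Real.log 2)) ≤
      1 + (2 * (r * (π.fronthaulTime D * Real.log P))
        + (∑ m, ∑ k ∈ A, μ m (D k)) * (L * Real.log 2)) := by
  have hregion (g : CSI) (F : Library J L) : MeasurableSet {z | (F, g, z) ∈ π.success D A} :=
    measurable_prodMk_left (measurable_prodMk_left (π.measurableSet_success D A))
  have hcount := π.success_mul_log_le (ν := ν) D A MeasurableSet.univ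
    (π.measurable_networkMessages D A) (c := 0) measurable_zero (integrable_zero _ _ _) le_rfl
    (noiseLaw (π.edgeTime D)) hregion (fun g _ F => by simp)
    (fun g _ => π.resolves_networkMessages D A g)
  have hmessages : (∑ i, ∫ g, entropy (libraryLaw J L) (π.networkMessages D A i · g) ∂csiLaw ν)
      * Real.log 2 ≤ ∑ _m : Fin 2, r * (π.fronthaulTime D * Real.log P)
        + ∑ m, ∑ k : A, μ m (D k) * (L * Real.log 2) := by
    simp only [networkMessages, Fintype.sum_sum_type, Sum.elim_inl, Sum.elim_inr,
      Fintype.sum_prod_type, integral_const, probReal_univ, one_smul, add_mul, Finset.sum_mul]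
    exact add_le_add
      (Finset.sum_le_sum fun m _ => hfront.integral_entropy_mul_log_le D m)
      (Finset.sum_le_sum fun m _ => Finset.sum_le_sum fun k _ =>
        hcache.entropy_mul_log_le m (D k))
  have hcontents : ∑ m, ∑ k : A, μ m (D k) = ∑ m, ∑ k ∈ A, μ m (D k) :=
    Finset.sum_congr rfl fun m _ => Finset.sum_coe_sort A fun k => μ m (D k)
  simp only [probReal_univ, Pi.zero_apply, integral_zero, add_zero] at hcount
  simp only [Fin.sum_const, nsmul_eq_mul, Nat.cast_ofNat, ← Finset.sum_mul,
    hcontents] at hmessages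
  linarith

end Fronthaul

section Pair

variable {m m' k l : Fin 2}

theorem noiseless_eq_of_ne (hm : m ≠ m') (k : Fin 2) (F : Library J L) (g : CSI) :
    π.noiseless D k F g = g m k • π.codeword m D F g + g m' k • π.codeword m' D F g := by
  have hc : (m = 0 ∧ m' = 1) ∨ (m = 1 ∧ m' = 0) := by omega
  rw [noiseless, Fin.sum_univ_two]
  rcases hc with ⟨rfl, rfl⟩ | ⟨rfl, rfl⟩
  · rfl
  · exact add_comm _ _

theorem noiseless_eq_smul_noiseless_add (hm : m ≠ m') {g : CSI} (hg : g m' k ≠ 0)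
    (l : Fin 2) (F : Library J L) :
    π.noiseless D l F g = (g m' l / g m' k) • π.noiseless D k F g +
      (g m l - g m' l / g m' k * g m k) • π.codeword m D F g := by
  rw [π.noiseless_eq_of_ne D hm, π.noiseless_eq_of_ne D hm, smul_add, smul_smul, smul_smul,
    div_mul_cancel₀ _ hg, sub_smul]
  abel

variable (m m' k l) in
/-- The pairs consisting of a signal received by user `k` and a residual, from which the files of
both users are decoded: once the codeword of EN `m` is known, subtracting the signal at user `k`,
scaled by `g m' l / g m' k`, from the one at user `l` cancels the codeword of EN `m'`. -/
def pairRegion (g : CSI) (F : Library J L) :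
    Set (Signal (π.edgeTime D) × Signal (π.edgeTime D)) :=
  {q | π.decode k D q.1 g = F (D k) ∧ π.decode l D (q.2 + ((g m' l / g m' k) • q.1 +
    (g m l - g m' l / g m' k * g m k) • π.codeword m D F g)) g = F (D l)}

theorem measurableSet_pairRegion (g : CSI) (F : Library J L) :
    MeasurableSet (π.pairRegion D m m' k l g F) := by
  have hsignal : Measurable fun q : Signal (π.edgeTime D) × Signal (π.edgeTime D) =>
      q.2 + ((g m' l / g m' k) • q.1 +
        (g m l - g m' l / g m' k * g m k) • π.codeword m D F g) := by fun_prop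
  exact (measurable_fst (π.measurableSet_decode_eq D k g _)).inter
    (hsignal (π.measurableSet_decode_eq D l g _))

variable (m l) in
/-- The fronthaul message of EN `m`, and what it caches of the file requested by user `l`. -/
def nodeMessages : Fin 2 → Library J L → CSI → ℕ :=
  ![π.fronthaul m D, fun F _ => π.cache m (D l) (F (D l))]

theorem measurable_nodeMessages (i : Fin 2) (F : Library J L) :
    Measurable (π.nodeMessages D m l i F) := by
  fin_cases i
  · exact π.measurable_fronthaul m D F
  · exact measurable_const

theorem resolves_pairRegion (hkl : k ≠ l) (m m' : Fin 2) (g : CSI) :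
    Resolves (Finset.univ.map D) (fun i F => π.nodeMessages D m l i F g)
      (π.pairRegion D m m' k l g) := fun q F F' hF hF' hrest hV => by
  have huniv (i : Fin 2) : i = k ∨ i = l := by omega
  have hk : F (D k) = F' (D k) := hF.1.symm.trans hF'.1
  have hcodeword : π.codeword m D F g = π.codeword m D F' g := by
    refine π.codeword_congr D hrest (fun j hj => ?_) (hV 0)
    obtain ⟨i, -, rfl⟩ := Finset.mem_map.1 hj
    rcases huniv i with rfl | rfl
    · rw [hk]
    · exact hV 1
  have hl : F (D l) = F' (D l) := by
    have hdecode := hF.2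
    rw [hcodeword] at hdecode
    exact hdecode.symm.trans hF'.2
  intro j hj
  obtain ⟨i, -, rfl⟩ := Finset.mem_map.1 hj
  rcases huniv i with rfl | rfl <;> assumption

theorem setLIntegral_success_pair_le (hm : m ≠ m') (hkl : k ≠ l) {K P : ℝ}
    (hP : 0 < P) {g : CSI} (hg : g ∈ boundedCSI K) (F : Library J L) :
    ∫⁻ z in {z | (F, g, z) ∈ π.success D Finset.univ}, ENNReal.ofReal (Real.exp
        (-(π.receivedCost D K P k (F, g, z) + residualCost (K ^ 2) k l (F, g, z))))
      ∂noiseLaw (π.edgeTime D)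
      ≤ (gaussianLaw (π.edgeTime D) P).prod (gaussianLaw (π.edgeTime D) 1)
          (π.pairRegion D m m' k l g F) := by
  refine le_trans ?_ (setLIntegral_noiseLaw_pair_le hkl P 1 (π.noiseless D k F g)
    (g m' l / g m' k) (π.measurableSet_pairRegion D g F))
  refine lintegral_mono' (Measure.restrict_mono (fun z hz => ?_) le_rfl) fun z => ?_
  · have hk := hz k (Finset.mem_univ k)
    have hl : π.decode l D (z l + π.noiseless D l F g) g = F (D l) := hz l (Finset.mem_univ l)
    rw [π.noiseless_eq_smul_noiseless_add D hm (ne_zero_of_mem_boundedCSI hg m' k)] at hl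
    refine ⟨hk, ?_⟩
    convert hl using 2
    module
  · gcongr
    · exact π.gaussianCost_received_le D hP (fun m k => (hg m k).1) k F z
    · exact gaussianCost_residual_le (norm_div_le_of_mem_boundedCSI hg m' k l) k l F g z

variable {π} {ν : Measure ℂ} [IsProbabilityMeasure ν]

theorem pair_converse (hm : m ≠ m') (hkl : k ≠ l) {r P : ℝ} (hP : 1 ≤ P) {μ : Fin 2 → Fin J → ℝ}
    (hcache : π.CacheConstraint μ) (hfront : π.FronthaulConstraint ν r P)
    (hpow : π.PowerConstraint ν P) (K : ℝ) :
    ((csiLaw ν).real (boundedCSI K) - 2 * π.maxErrorProb ν) * (2 * (L * Real.log 2)) ≤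
      1 + (r * (π.fronthaulTime D * Real.log P) + μ m (D l) * (L * Real.log 2)
        + (π.edgeTime D * Real.log P + π.edgeTime D * (4 + 8 * K ^ 2 + 2 * K ^ 4))) := by
  have hP0 : 0 < P := one_pos.trans_le hP
  have := isProbabilityMeasure_gaussianLaw (n := π.edgeTime D) hP0
  have := isProbabilityMeasure_gaussianLaw (n := π.edgeTime D) one_pos
  have hreceived := hpow.integrable_receivedCost D K k
  have hresidual : Integrable _ (systemLaw J L (π.edgeTime D) ν) :=
    integrable_residualCost (K ^ 2) k l
  have hcount := π.success_mul_log_le D Finset.univ (measurableSet_boundedCSI K)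
    (V := π.nodeMessages D m l) (π.measurable_nodeMessages D)
    (c := fun ω => π.receivedCost D K P k ω + residualCost (K ^ 2) k l ω) (by fun_prop)
    (hreceived.add hresidual)
    (add_nonneg (π.receivedCost_nonneg D hP K k) (residualCost_nonneg (K ^ 2) k l)) _
    (fun g F => π.measurableSet_pairRegion D (m := m) (m' := m') (k := k) (l := l) g F)
    (fun g hg => π.setLIntegral_success_pair_le D hm hkl hP0 hg)
    (fun g _ => π.resolves_pairRegion D hkl m m' g)
  have hcost := hpow.integral_receivedCost_le D hP K k
  have hmessages : (∑ i, ∫ g, entropy (libraryLaw J L) (π.nodeMessages D m l i · g) ∂csiLaw ν)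
      * Real.log 2 ≤ r * (π.fronthaulTime D * Real.log P) + μ m (D l) * (L * Real.log 2) := by
    rw [Fin.sum_univ_two, add_mul]
    exact add_le_add (hfront.integral_entropy_mul_log_le D m)
      (by simpa [nodeMessages] using hcache.entropy_mul_log_le m (D l))
  rw [integral_add hreceived hresidual, integral_residualCost] at hcount
  simp only [Finset.card_univ, Fintype.card_fin, Nat.cast_ofNat] at hcount
  linarith

end Pair

end Policy

/-! ### Large files and high SNR -/

theorem ae_csiLaw_ne_zero {ν : Measure ℂ} [IsProbabilityMeasure ν] (hν : ν {0} = 0) :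
    ∀ᵐ g ∂csiLaw ν, ∀ m k, g m k ≠ 0 := by
  refine ae_all_iff.2 fun m => ae_all_iff.2 fun k => ?_
  have hne : ∀ᵐ z ∂ν, z ≠ 0 := by simpa [ae_iff] using hν
  exact (measurePreserving_eval (fun _ => Measure.pi fun _ => ν) m).quasiMeasurePreserving.ae
    ((measurePreserving_eval (fun _ => ν) k).quasiMeasurePreserving.ae hne)

theorem monotone_boundedCSI : Monotone fun N : ℕ => boundedCSI N := fun N N' hN g hg m k => by
  have hcast : (N : ℝ) ≤ N' := by exact_mod_cast hN
  exact ⟨(hg m k).1.trans hcast, (hg m k).2.trans (by gcongr)⟩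

theorem mem_iUnion_boundedCSI {g : CSI} (hg : ∀ m k, g m k ≠ 0) :
    g ∈ ⋃ N : ℕ, boundedCSI N := by
  obtain ⟨N, hN⟩ := exists_nat_ge (∑ p : Fin 2 × Fin 2, (‖g p.1 p.2‖ + ‖g p.1 p.2‖⁻¹))
  refine Set.mem_iUnion.2 ⟨N, fun m k => ?_⟩
  have hpos : 0 < ‖g m k‖ := norm_pos_iff.2 (hg m k)
  have hinv : 0 < ‖g m k‖⁻¹ := inv_pos.2 hpos
  have hle : ‖g m k‖ + ‖g m k‖⁻¹ ≤ N :=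
    (Finset.single_le_sum (f := fun p : Fin 2 × Fin 2 => ‖g p.1 p.2‖ + ‖g p.1 p.2‖⁻¹)
      (fun p _ => by positivity) (Finset.mem_univ (m, k))).trans hN
  exact ⟨by linarith, (inv_le_iff_one_le_mul₀ hpos).1 (by linarith)⟩

theorem tendsto_csiLaw_boundedCSI {ν : Measure ℂ} [IsProbabilityMeasure ν] (hν : ν {0} = 0) :
    Tendsto (fun N : ℕ => (csiLaw ν).real (boundedCSI N)) atTop (𝓝 1) := by
  have hunion : csiLaw ν (⋃ N : ℕ, boundedCSI N) = 1 :=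
    (mem_ae_iff_prob_eq_one (MeasurableSet.iUnion fun N : ℕ => measurableSet_boundedCSI N)).1 <|
      (ae_csiLaw_ne_zero hν).mono fun _ hg => mem_iUnion_boundedCSI hg
  have hlim := tendsto_measure_iUnion_atTop (μ := csiLaw ν) monotone_boundedCSI
  rw [hunion] at hlim
  exact (ENNReal.tendsto_toReal ENNReal.one_ne_top).comp hlim

namespace IteratedLimit

variable {f f' : ℕ → ℝ → ℝ} {a a' : ℝ}

theorem add (hf : IteratedLimit f a) (hf' : IteratedLimit f' a') :
    IteratedLimit (fun L P => f L P + f' L P) (a + a') :=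
  let ⟨g, hL, hP⟩ := hf
  let ⟨g', hL', hP'⟩ := hf'
  ⟨fun P => g P + g' P, by filter_upwards [hL, hL'] with P h h' using h.add h', hP.add hP'⟩

theorem mul (hf : IteratedLimit f a) (hf' : IteratedLimit f' a') :
    IteratedLimit (fun L P => f L P * f' L P) (a * a') :=
  let ⟨g, hL, hP⟩ := hf
  let ⟨g', hL', hP'⟩ := hf'
  ⟨fun P => g P * g' P, by filter_upwards [hL, hL'] with P h h' using h.mul h', hP.mul hP'⟩

theorem of_tendsto_length {u : ℕ → ℝ} (hu : Tendsto u atTop (𝓝 a)) :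
    IteratedLimit (fun L _ => u L) a :=
  ⟨fun _ => a, Eventually.of_forall fun _ => hu, tendsto_const_nhds⟩

theorem of_tendsto_snr {v : ℝ → ℝ} (hv : Tendsto v atTop (𝓝 a)) :
    IteratedLimit (fun _ P => v P) a :=
  ⟨v, Eventually.of_forall fun _ => tendsto_const_nhds, hv⟩

theorem const (c : ℝ) : IteratedLimit (fun _ _ => c) c := of_tendsto_snr tendsto_const_nhds

theorem le (hf : IteratedLimit f a) (hf' : IteratedLimit f' a')
    (hle : ∀ L P, L ≠ 0 → 1 < P → f L P ≤ f' L P) : a ≤ a' := by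
  obtain ⟨g, hL, hP⟩ := hf
  obtain ⟨g', hL', hP'⟩ := hf'
  refine le_of_tendsto_of_tendsto hP hP' ?_
  filter_upwards [hL, hL', eventually_gt_atTop 1] with P h h' hP1
  refine le_of_tendsto_of_tendsto h h' ?_
  filter_upwards [eventually_ne_atTop 0] with L hL0 using hle L P hL0 hP1

theorem mul_le_of_code_bound {ε x : ℕ → ℝ → ℝ} {p b X : ℝ} (hε : IteratedLimit ε 0)
    (hx : IteratedLimit x X)
    (hle : ∀ L P, L ≠ 0 → 1 < P →
      (p - b * ε L P) * (b * (L * Real.log 2)) ≤ 1 + x L P * (L * Real.log 2)) :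
    p * b ≤ X := by
  have hleft : IteratedLimit (fun L P => p * b + -b ^ 2 * ε L P) (p * b) := by
    simpa using (const (p * b)).add ((const (-b ^ 2)).mul hε)
  have hright : IteratedLimit (fun L P => 1 / (L : ℝ) * (1 / Real.log 2) + x L P) X := by
    simpa using ((of_tendsto_length tendsto_one_div_atTop_nhds_zero_nat).mul
      (const (1 / Real.log 2))).add hx
  refine hleft.le hright fun L P hL hP => ?_
  have hsize : 0 < L * Real.log 2 := by positivity
  rw [← mul_le_mul_iff_of_pos_right hsize]
  have hunit : (1 / (L : ℝ) * (1 / Real.log 2)) * (L * Real.log 2) = 1 := by field_simp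
  linarith [hle L P hL hP]

end IteratedLimit

/-- A duration of `n` symbols, in units of the time `L / log₂ P` that it takes to send a file of
`L` bits at the rate `log₂ P`. -/
def normalizedTime (n L : ℕ) (P : ℝ) : ℝ := n / (L / Real.logb 2 P)

theorem normalizedTime_mul {n L : ℕ} (hL : L ≠ 0) (P : ℝ) :
    normalizedTime n L P * (L * Real.log 2) = n * Real.log P := by
  have hlog : Real.log 2 ≠ 0 := (Real.log_pos one_lt_two).ne'
  rw [normalizedTime, Real.logb]
  field_simp

theorem IteratedLimit.normalizedTime_nonneg {n : ℕ → ℝ → ℕ} {δ : ℝ}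
    (h : IteratedLimit (fun L P => normalizedTime (n L P) L P) δ) : 0 ≤ δ :=
  (const 0).le h fun L P _ hP => by
    have := Real.logb_nonneg one_lt_two hP.le
    unfold normalizedTime
    positivity

theorem IteratedLimit.normalizedTime_mul_one_add {n : ℕ → ℝ → ℕ} {δ : ℝ}
    (h : IteratedLimit (fun L P => normalizedTime (n L P) L P) δ) (C : ℝ) :
    IteratedLimit (fun L P => normalizedTime (n L P) L P * (1 + C / Real.log P)) δ := by
  simpa using h.mul ((const 1).add (of_tendsto_snr (Real.tendsto_log_atTop.const_div_atTop C)))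

theorem normalizedTime_mul_one_add_mul {n L : ℕ} (hL : L ≠ 0) {P : ℝ} (hP : 1 < P) (C : ℝ) :
    normalizedTime n L P * (1 + C / Real.log P) * (L * Real.log 2) =
      n * Real.log P + n * C := by
  have hlog : Real.log P ≠ 0 := (Real.log_pos hP).ne'
  rw [mul_right_comm, normalizedTime_mul hL]
  field_simp

namespace IsFeasible

variable {J : ℕ} {ν : Measure ℂ} [IsProbabilityMeasure ν] {r : ℝ} {μ : Fin 2 → Fin J → ℝ}
  {π : (L : ℕ) → ℝ → Policy J L} (hπ : IsFeasible ν r μ π) (D : Demand J) {δf δe : ℝ}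

include hπ

theorem one_le_edge (hν : ν {0} = 0)
    (he : IteratedLimit (fun L P => normalizedTime ((π L P).edgeTime D) L P) δe) : 1 ≤ δe := by
  refine le_of_tendsto' (tendsto_csiLaw_boundedCSI hν) fun N => ?_
  rw [← mul_one ((csiLaw ν).real _)]
  refine hπ.error.mul_le_of_code_bound (he.normalizedTime_mul_one_add (2 + 8 * (N : ℝ) ^ 2))
    fun L P hL hP => ?_
  have hcode := Policy.edge_converse D hP.le (hπ.power L P hP) N 0
  rw [normalizedTime_mul_one_add_mul hL hP]
  linarith

theorem two_le_edge_add_fronthaul (hν : ν {0} = 0)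
    (hf : IteratedLimit (fun L P => normalizedTime ((π L P).fronthaulTime D) L P) δf)
    (he : IteratedLimit (fun L P => normalizedTime ((π L P).edgeTime D) L P) δe)
    (m l : Fin 2) : 2 ≤ δe + r * δf + μ m (D l) := by
  obtain ⟨m', hm⟩ := exists_ne m
  obtain ⟨k, hkl⟩ := exists_ne l
  have hlim := (tendsto_csiLaw_boundedCSI hν).mul_const 2
  rw [one_mul] at hlim
  refine le_of_tendsto' hlim fun N => ?_
  refine hπ.error.mul_le_of_code_bound
    (((he.normalizedTime_mul_one_add (4 + 8 * (N : ℝ) ^ 2 + 2 * (N : ℝ) ^ 4)).add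
      ((IteratedLimit.const r).mul hf)).add (IteratedLimit.const (μ m (D l))))
    fun L P hL hP => ?_
  have hcode := Policy.pair_converse D hm.symm hkl hP.le (hπ.cache L P hP) (hπ.fronthaul L P hP)
    (hπ.power L P hP) N
  rw [add_mul, add_mul, normalizedTime_mul_one_add_mul hL hP, mul_assoc, normalizedTime_mul hL]
  linarith

theorem card_le_fronthaul
    (hf : IteratedLimit (fun L P => normalizedTime ((π L P).fronthaulTime D) L P) δf)
    (A : Finset (Fin 2)) : (A.card : ℝ) ≤ 2 * (r * δf) + ∑ m, ∑ k ∈ A, μ m (D k) := by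
  rw [← one_mul (A.card : ℝ)]
  refine hπ.error.mul_le_of_code_bound
    (((IteratedLimit.const 2).mul ((IteratedLimit.const r).mul hf)).add (IteratedLimit.const _))
    fun L P hL hP => ?_
  have hcode := Policy.fronthaul_converse D (hπ.cache L P hP) (hπ.fronthaul L P hP) A
  rw [add_mul, mul_assoc, mul_assoc, normalizedTime_mul hL]
  exact hcode

end IsFeasible

/-! ### The outer bound -/

section OuterBound

variable {J : ℕ} {μ : Fin 2 → Fin J → ℝ} {r : ℝ} {i j : Fin J} {x y : ℝ}

theorem two_sub_minCache_le (hi : ∀ m, 2 ≤ x + μ m i) (hj : ∀ m, 2 ≤ x + μ m j) :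
    2 - minCache μ i j ≤ x := by
  have hmin : 2 - x ≤ minCache μ i j :=
    le_min (le_min (by linarith [hi 0]) (by linarith [hi 1]))
      (le_min (by linarith [hj 0]) (by linarith [hj 1]))
  linarith

theorem add_eq_add_mul_add_mul (hr : 0 < r) :
    x + y = (x + r * y) + (1 / r - 1) * (r * y) := by
  field_simp
  ring

theorem outer1_le (hr : 0 < r) (hr1 : r ≤ 1) (hxy : 2 - minCache μ i j ≤ x + r * y)
    (hy : 2 ≤ 2 * (r * y) + (μ 0 i + μ 1 i + μ 0 j + μ 1 j)) : outer1 μ r i j ≤ x + y := by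
  have hinv : 0 ≤ 1 / r - 1 := sub_nonneg.2 (one_le_one_div hr hr1)
  calc outer1 μ r i j
      = (2 - minCache μ i j) + (1 / r - 1) * (1 - (μ 0 i + μ 1 i + μ 0 j + μ 1 j) / 2) := by
        rw [outer1]; ring
    _ ≤ (x + r * y) + (1 / r - 1) * (r * y) := by gcongr; linarith
    _ = x + y := (add_eq_add_mul_add_mul hr).symm

theorem outer2_le (hr : 0 < r) (hr1 : r ≤ 1) (hxy : 2 - minCache μ i j ≤ x + r * y)
    (hi : 1 ≤ 2 * (r * y) + (μ 0 i + μ 1 i)) (hj : 1 ≤ 2 * (r * y) + (μ 0 j + μ 1 j)) :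
    outer2 μ r i j ≤ x + y := by
  have hinv : 0 ≤ 1 / r - 1 := sub_nonneg.2 (one_le_one_div hr hr1)
  have hmin : 1 - 2 * (r * y) ≤ min (μ 0 i + μ 1 i) (μ 0 j + μ 1 j) :=
    le_min (by linarith) (by linarith)
  calc outer2 μ r i j
      = (2 - minCache μ i j) +
          (1 / r - 1) * ((1 - min (μ 0 i + μ 1 i) (μ 0 j + μ 1 j)) / 2) := by
        rw [outer2]; field_simp; ring
    _ ≤ (x + r * y) + (1 / r - 1) * (r * y) := by gcongr; linarith
    _ = x + y := (add_eq_add_mul_add_mul hr).symm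

theorem outer3_le (hr1 : r ≤ 1) (hy : 0 ≤ y) (hxy : 2 - minCache μ i j ≤ x + r * y) :
    outer3 μ i j ≤ x + y :=
  hxy.trans (by gcongr; exact mul_le_of_le_one_left hy hr1)

theorem outer4_le (hr1 : 1 ≤ r) (hx : 1 ≤ x) (hxy : 2 - minCache μ i j ≤ x + r * y) :
    outer4 μ r i j ≤ x + y := by
  have hr : 0 < r := one_pos.trans_le hr1
  have hinv : 0 ≤ 1 - 1 / r := sub_nonneg.2 ((div_le_one hr).2 hr1)
  calc outer4 μ r i j
      = 1 / r * (2 - minCache μ i j) + (1 - 1 / r) * 1 := by rw [outer4]; ring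
    _ ≤ 1 / r * (x + r * y) + (1 - 1 / r) * x := by gcongr
    _ = x + y := by field_simp; ring

theorem outerBound_le (hr : 0 < r) (hx : 1 ≤ x) (hy : 0 ≤ y)
    (hi : ∀ m, 2 ≤ x + r * y + μ m i) (hj : ∀ m, 2 ≤ x + r * y + μ m j)
    (hij : 2 ≤ 2 * (r * y) + (μ 0 i + μ 1 i + μ 0 j + μ 1 j))
    (hyi : 1 ≤ 2 * (r * y) + (μ 0 i + μ 1 i)) (hyj : 1 ≤ 2 * (r * y) + (μ 0 j + μ 1 j)) :
    outerBound μ r i j ≤ x + y := by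
  have hxy := two_sub_minCache_le hi hj
  rw [outerBound]
  split_ifs with hr1
  · exact max_le (outer1_le hr hr1 hxy hij)
      (max_le (outer2_le hr hr1 hxy hyi hyj) (outer3_le hr1 hy hxy))
  · exact outer4_le (le_of_not_ge hr1) hx hxy

end OuterBound

theorem toSet_embFinTwo {J : ℕ} {i j : Fin J} (hij : i ≠ j) :
    Demand.toSet (Function.Embedding.embFinTwo hij) = pairSet i j hij := by
  ext a
  simp [Demand.toSet, pairSet, eq_comm (a := a), Function.Embedding.embFinTwo_apply_zero,
    Function.Embedding.embFinTwo_apply_one]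

theorem IsFeasible.outerBound_le {J : ℕ} {ν : Measure ℂ} [IsProbabilityMeasure ν] {r : ℝ}
    {μ : Fin 2 → Fin J → ℝ} {π : (L : ℕ) → ℝ → Policy J L} (hπ : IsFeasible ν r μ π)
    (hν : ν {0} = 0) (hr : 0 < r) (D : Demand J) {δf δe : ℝ}
    (hf : IteratedLimit (fun L P => normalizedTime ((π L P).fronthaulTime D) L P) δf)
    (he : IteratedLimit (fun L P => normalizedTime ((π L P).edgeTime D) L P) δe) :
    outerBound μ r (D 0) (D 1) ≤ δe + δf := by
  have hpair := hπ.two_le_edge_add_fronthaul D hν hf he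
  have hboth : 2 ≤ 2 * (r * δf) + (μ 0 (D 0) + μ 1 (D 0) + μ 0 (D 1) + μ 1 (D 1)) := by
    have h := hπ.card_le_fronthaul D hf Finset.univ
    simp only [Finset.card_univ, Fintype.card_fin, Fin.sum_univ_two, Nat.cast_ofNat] at h
    linarith
  have hsingle (k : Fin 2) : 1 ≤ 2 * (r * δf) + (μ 0 (D k) + μ 1 (D k)) := by
    simpa only [Finset.card_singleton, Finset.sum_singleton, Fin.sum_univ_two, Nat.cast_one]
      using hπ.card_le_fronthaul D hf {k}
  exact FRAN.outerBound_le hr (hπ.one_le_edge D hν he) hf.normalizedTime_nonneg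
    (fun m => hpair m 0) (fun m => hpair m 1) hboth (hsingle 0) (hsingle 1)

end FRAN

end

theorem theorem2_general {J : ℕ} (ν : MeasureTheory.Measure ℂ)
    [MeasureTheory.IsProbabilityMeasure ν] (hν : ν {0} = 0) (r : ℝ) (hr : 0 < r)
    (μ : Fin 2 → Fin J → ℝ) : FRAN.ndtRegion ν r μ ⊆ FRAN.outerRegion μ r := by
  rintro δ ⟨π, hπ, δf, δe, hf, he, hδ⟩ i j hij
  let D : FRAN.Demand J := Function.Embedding.embFinTwo hij
  have hbound : FRAN.outerBound μ r i j ≤ δe D + δf D :=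
    hπ.outerBound_le hν hr D (hf D) (he D)
  rwa [← hδ D, FRAN.toSet_embFinTwo hij] at hbound

theorem theorem2 {J : ℕ} (ν : MeasureTheory.Measure ℂ) [MeasureTheory.IsProbabilityMeasure ν]
    [MeasureTheory.NullSingletonClass ν] (r : ℝ) (hr : 0 < r) (μ : Fin 2 → Fin J → ℝ)
    (hμ : ∀ m j, μ m j ∈ Set.Icc (0 : ℝ) 1) :
    FRAN.ndtRegion ν r μ ⊆ FRAN.outerRegion μ r :=
  theorem2_general ν (MeasureTheory.measure_singleton 0) r hr μ
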